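/- \textbf{Theorem (Cubical Gale Evenness Criterion).} Let $n\ge d\ge 2$ be integers. For $\varepsilon>0$ let \[ C^n(\varepsilon)=\Bigl\{x\in\mathbb R^n:\ \varepsilon|x_k|\le \frac{2^{\binom k2}}{\varepsilon^{k-1}}-(-1)^k\sum_{j=1}^{k-1}\binom{k-2}{j-1}x_j\ \text{ for } 1\le k\le n\Bigr\}, \] let $\pi:\mathbb R^n\to\mathbb R^d$, $(x_1,\dots,x_n)\mapsto(x_{n-d+1},\dots,x_n)$, and put $C_d^n=C_d^n(\varepsilon)=\pi(C^n(\varepsilon))$. For a set $\alpha\subseteq\{\pm1,\dots,\pm n\}$ let $F_\alpha$ be the set of all $x\in C^n(\varepsilon)$ with \[ (-1)^k\sum_{j=1}^{k-1}\binom{k-2}{j-1}x_j+\sigma\varepsilon x_k=\frac{2^{\binom k2}}{\varepsilon^{k-1}}\quad\text{ for all } \sigma k\in\alpha\ \ (1\le k\le n,\ \sigma\in\{-1,+1\}). \] A set $\beta\subseteq\{\pm1,\dots,\pm n\}$ satisfies the (simplicial) \emph{Gale evenness criterion} if for any two elements $a,b\in\beta$ with $|a|<|b|$ the number of integers $k$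 with $|a|<k<|b|$ and $k,-k\notin\beta$ is even; $\min\beta$ denotes the smallest absolute value of an element of $\beta$. Then there is $\varepsilon_0>0$, depending only on $n$ and $d$, such that for every $0<\varepsilon<\varepsilon_0$ the facets of $C_d^n(\varepsilon)$ are given by the subsets \[ \alpha\subseteq\{-1,+1,-2,+2,\dots,-n,+n\},\qquad \#\alpha=n-d+1,\qquad \alpha\cap(-\alpha)=\emptyset \] of one of the following forms (the case is determined by $p=\min\{i\ge0:\ \pm(i+1)\notin\alpha\}$): \begin{itemize} \item $p=0$: $\pm1\notin\alpha$, and $\alpha$ satisfies the Gale evenness criterion. \item $1\le p\le n-d+1$: $\alpha=\{-1,+2,\dots,(-1)^{p-1}(p-1),\,\sigma p\}\cup\alpha^{(p)}$, where $\sigma\in\{-1,+1\}$, $\#\alpha^{(p)}=n-d+1-p$, and if $\alpha^{(p)}\ne\emptyset$, then (1) $\min\alpha^{(p)}>p+1$; (2) $\alpha^{(p)}$ satisfies the Gale evenness criterion; (3) if $\sigma=(-1)^{p+1}$ then $\min\alpha^{(p)}-p$ is even, and if $\sigma=(-1)^p$ then $\min\alpha^{(p)}-p$ is odd. \end{itemize}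 More precisely: for every $\alpha\subseteq\{\pm1,\dots,\pm n\}$ with $\#\alpha=n-d+1$ and $\alpha\cap(-\alpha)=\emptyset$, the set $\pi(F_\alpha)$ is a facet of $C_d^n(\varepsilon)$ if and only if $\alpha$ has one of these forms, and $\alpha\mapsto\pi(F_\alpha)$ is a bijection from the set of all $\alpha$ of these forms onto the set of facets of $C_d^n(\varepsilon)$. -/

import Mathlib

namespace CubicalGale

open Finset

/-- The sum `(-1)^k * ∑_{j=1}^{k-1} binom (k-2) (j-1) * x_j` for `k = i + 1`. Coordinates are
indexed by `Fin n`, so the coordinate called `x_k` in one-based numbering is `x i` with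
`k = i + 1` (and for `k = 1` the sum is empty). -/
noncomputable def lowerPart {n : ℕ} (x : Fin n → ℝ) (i : Fin n) : ℝ :=
  (-1) ^ ((i : ℕ) + 1) * ∑ j ∈ Finset.Iio i, (((i : ℕ) - 1).choose (j : ℕ) : ℝ) * x j

/-- The right-hand side `2 ^ (binom k 2) / ε ^ (k - 1)` for `k = i + 1`. -/
noncomputable def bound (ε : ℝ) (i : ℕ) : ℝ :=
  2 ^ ((i + 1).choose 2) / ε ^ i

/-- The deformed cube `C^n(ε)`: all `x` with
`ε |x_k| ≤ 2 ^ (binom k 2) / ε ^ (k - 1) - (-1)^k ∑_{j<k} binom (k-2) (j-1) x_j`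
for `1 ≤ k ≤ n`. -/
def deformedCube (n : ℕ) (ε : ℝ) : Set (Fin n → ℝ) :=
  {x | ∀ i : Fin n, ε * |x i| ≤ bound ε i - lowerPart x i}

/-- The projection of `ℝ^n` to `ℝ^d` that keeps the last `d` coordinates. -/
def projLast {d n : ℕ} (h : d ≤ n) : (Fin n → ℝ) →ₗ[ℝ] (Fin d → ℝ) :=
  LinearMap.funLeft ℝ ℝ (fun j : Fin d => (⟨n - d + j, by omega⟩ : Fin n))

/-- The projected deformed cube `C_d^n(ε)`. -/
def cubicalPolytope {d n : ℕ} (h : d ≤ n) (ε : ℝ) : Set (Fin d → ℝ) :=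
  projLast h '' deformedCube n ε

/-- The face of `C^n(ε)` on which, for each signed index `σ k ∈ α` (`1 ≤ k ≤ n`, `σ = ±1`), the
inequality `(-1)^k ∑_{j<k} binom (k-2) (j-1) x_j + σ ε x_k ≤ 2 ^ (binom k 2) / ε ^ (k - 1)`
is tight. -/
def cubeFace (n : ℕ) (ε : ℝ) (α : Finset ℤ) : Set (Fin n → ℝ) :=
  {x | x ∈ deformedCube n ε ∧ ∀ i : Fin n, ∀ σ : ℤ, (σ = 1 ∨ σ = -1) →
    σ * ((i : ℤ) + 1) ∈ α → lowerPart x i + (σ : ℝ) * ε * x i = bound ε i}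

/-- `F` is a facet of the convex set `P`: a nonempty face, cut out by a linear functional
attaining its maximum over `P` exactly on `F`, with `dim F = dim P - 1`. -/
def IsFacet {d : ℕ} (P F : Set (Fin d → ℝ)) : Prop :=
  F.Nonempty ∧ IsExposed ℝ P F ∧
    Module.finrank ℝ (vectorSpan ℝ F) + 1 = Module.finrank ℝ (vectorSpan ℝ P)

/-- `α ⊆ {±1, …, ±n}` with `α ∩ (-α) = ∅`. -/
def IsSignedSubset (n : ℕ) (α : Finset ℤ) : Prop :=
  (∀ a ∈ α, 1 ≤ |a| ∧ |a| ≤ n) ∧ ∀ a ∈ α, -a ∉ α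

/-- The simplicial Gale evenness criterion for the absolute values of `α`: between any two of
them there is an even number of `k` with `k ∉ α` and `-k ∉ α`. -/
def GaleEven (α : Finset ℤ) : Prop :=
  ∀ a ∈ α, ∀ b ∈ α, |a| < |b| →
    Even (#{k ∈ Finset.Ioo |a| |b| | k ∉ α ∧ -k ∉ α})

/-- The set `{-1, +2, …, (-1)^(p-1) (p-1), σ p}`. -/
def signPrefix (p : ℕ) (σ : ℤ) : Finset ℤ :=
  insert (σ * (p : ℤ)) ((Finset.Icc 1 (p - 1)).image fun i : ℕ => (-1) ^ i * (i : ℤ))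

/-- The form of `α` in the case `p = 0`. -/
def FormZero (α : Finset ℤ) : Prop :=
  1 ∉ α ∧ -1 ∉ α ∧ GaleEven α

/-- The form of `α` in a case `p ≥ 1`. Here `β` is the remainder `α^(p)`, and `min β` is the least
absolute value of an element of `β`. -/
def FormPos (n d p : ℕ) (α : Finset ℤ) : Prop :=
  ∃ (σ : ℤ) (β : Finset ℤ), (σ = 1 ∨ σ = -1) ∧
    α = signPrefix p σ ∪ β ∧ #β = n - d + 1 - p ∧
    ∀ m : ℤ, IsLeast ((fun b : ℤ => |b|) '' (β : Set ℤ)) m →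
      (p : ℤ) + 1 < m ∧
      GaleEven β ∧
      (σ = (-1) ^ (p + 1) → Even (m - p)) ∧
      (σ = (-1) ^ p → Odd (m - p))

/-- The combinatorial condition of the cubical Gale evenness criterion, for signed subsets `α`
with `n - d + 1` elements. -/
def CubicalGaleEven (n d : ℕ) (α : Finset ℤ) : Prop :=
  FormZero α ∨ ∃ p : ℕ, 1 ≤ p ∧ p ≤ n - d + 1 ∧ FormPos n d p α

end CubicalGale

/-! Put `m = n - d`, and index coordinates and rows from 0. Each coordinate contributes two signed
rows, and by triangularity every functional on `ℝ^n` is a nonnegative combination that uses one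
signed row per coordinate. It factors through the projection exactly when its first `m` coefficients
vanish, that is, when the weights form a linear dependency of the rows truncated to `m` entries. Its
maximum over the polytope is then attained on `π(F_α)`, where `α` is the signed support. Moreover
`dim π(F_α)` plus the dimension of the space of dependencies among the rows of `α` equals `d`. If
every nonzero dependency of `m + 1` rows has full support, the facets are therefore the `π(F_α)` for
which `#α = m + 1` and the truncated rows have a positive dependency
(`HasExpectedSigns.isFacet_iff`).

It remains to find the signs of a dependency `v` for small `ε` (`exists_signPattern`). Up to the
factor `(-1)^(i+1)` and an entry `±ε` on the diagonal, row `i ≥ 1` is the point `(binom (i-1) q)_q`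
of a binomial moment curve. Pairing `v` with the Newton coefficients of a polynomial `f` of degree
below `m` gives `∑ (-1)^(i+1) v_i f(i) = O(ε)`. Let `p` be the first index missing from the support
`S`. Above `p`, an `f` that vanishes on all but two indices compares two entries, as in Gale's
criterion for cyclic polytopes (`upper_block`). The entry `p - 1` is visible only in the `ε`-term,
and is of order `1/ε` relative to the entries above the gap (`last_initial_entry`). Below it,
equation `q` reads `ε σ_q v_q ≈ (-1)^(q+1) v_(q+1)`, so each entry dominates the next
(`initial_entry_step`). Equality of all these signs is the cubical Gale evenness criterion
(`cubicalGaleEven_iff_signCondition`). -/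

namespace CubicalGale
open Finset Filter Topology

/-! ### Newton interpolation and a perturbation estimate -/

/-- Newton interpolation at `1, 2, …` of a product of distinct linear factors. -/
theorem exists_newton_coeff (Z : Finset ℕ) {m : ℕ} (hZ : #Z < m) :
    ∃ c : ℕ → ℝ,
      (∀ N : ℕ, ∏ z ∈ Z, (((N + 1 : ℕ) : ℝ) - z) = ∑ q ∈ range m, c q * (N.choose q : ℝ)) ∧
      ∀ q, Icc 1 (q + 1) ⊆ Z → c q = 0 := by
  classical
  set P : Polynomial ℝ := ∏ z ∈ Z, (Polynomial.X - Polynomial.C (z : ℝ)) with hP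
  have hdeg : P.natDegree = #Z := by
    rw [hP, Polynomial.natDegree_prod_of_monic _ _ fun z _ => Polynomial.monic_X_sub_C _,
      sum_congr rfl fun z _ => Polynomial.natDegree_X_sub_C _]
    simp
  have hev : ∀ x : ℝ, P.eval x = ∏ z ∈ Z, (x - z) := fun x => by
    simp [hP, Polynomial.eval_prod]
  -- The Newton coefficients are the forward differences at 1. Those of order at least `m` vanish by
  -- degree, and the `q`-th uses only the values at `1, …, q + 1`.
  refine ⟨fun q => (fwdDiff (1 : ℝ))^[q] (fun x => P.eval x) 1, fun N => ?_, fun q hq => ?_⟩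
  · have h := shift_eq_sum_fwdDiff_iter (1 : ℝ) (fun x => P.eval x) N 1
    have e : ((N + 1 : ℕ) : ℝ) = 1 + N • (1 : ℝ) := by simp [add_comm]
    rw [← hev, e, h]
    have h1 : ∀ k, m ≤ k → (fwdDiff (1 : ℝ))^[k] (fun x => P.eval x) 1 = 0 := fun k hk => by
      have := Polynomial.fwdDiff_iter_eq_zero_of_degree_lt (P := P) (n := k) (by omega)
      exact congrFun this 1
    calc _ = ∑ k ∈ range (N + 1 + m), N.choose k • (fwdDiff (1 : ℝ))^[k] (fun x => P.eval x) 1 := by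
          apply sum_subset (range_subset_range.2 (by omega))
          intro k _ hk
          rw [Nat.choose_eq_zero_of_lt (by simpa using hk), zero_smul]
      _ = ∑ k ∈ range m, N.choose k • (fwdDiff (1 : ℝ))^[k] (fun x => P.eval x) 1 := by
          symm
          apply sum_subset (range_subset_range.2 (by omega))
          intro k _ hk
          rw [h1 k (by simpa using hk), smul_zero]
      _ = _ := sum_congr rfl fun k _ => by rw [nsmul_eq_mul, mul_comm]
  · simp only [fwdDiff_iter_eq_sum_shift]
    refine sum_eq_zero fun k hk => ?_
    have hk' : k + 1 ∈ Z := hq (by simp at hk ⊢; omega)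
    have : P.eval (1 + k • (1 : ℝ)) = 0 := by
      rw [hev]
      exact prod_eq_zero hk' (by simp [add_comm])
    simp only [this, smul_zero]

theorem neg_one_pow_mul_prod_sub_pos (Z : Finset ℕ) (N : ℕ) (hN : N ∉ Z) :
    0 < (-1 : ℝ) ^ #{z ∈ Z | N < z} * ∏ z ∈ Z, ((N : ℝ) - z) := by
  classical
  induction Z using Finset.induction_on with
  | empty => simp
  | insert a s ha ih =>
    simp only [mem_insert, not_or] at hN
    have ih := ih hN.2
    rw [prod_insert ha, filter_insert]
    rcases lt_or_gt_of_ne hN.1 with h | h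
    · rw [if_pos h, card_insert_of_notMem (by simp [ha]), pow_succ]
      have : (0 : ℝ) < a - N := by
        have : (N : ℝ) < a := by exact_mod_cast h
        linarith
      nlinarith [mul_pos this ih]
    · rw [if_neg (by omega)]
      have : (0 : ℝ) < N - a := by
        have : (a : ℝ) < N := by exact_mod_cast h
        linarith
      nlinarith [mul_pos this ih]

theorem exists_pos_le_of_finset {ι : Type*} (s : Finset ι) (f : ι → ℝ) (h : ∀ i ∈ s, 0 < f i) :
    ∃ δ > 0, ∀ i ∈ s, δ ≤ f i := by
  classical
  induction s using Finset.induction_on with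
  | empty => exact ⟨1, one_pos, by simp⟩
  | insert a s ha ih =>
    obtain ⟨δ, hδ, hs⟩ := ih fun i hi => h i (mem_insert_of_mem hi)
    refine ⟨min δ (f a), lt_min hδ (h a (mem_insert_self _ _)), fun i hi => ?_⟩
    rcases mem_insert.1 hi with rfl | hi
    · exact min_le_right _ _
    · exact (min_le_left _ _).trans (hs i hi)

/-- If the entries of a vector satisfy, pair by pair, a perturbation of a two-term relation, then
for a small perturbation they are comparable and have the signs of the unperturbed relations. -/
theorem exists_comparable_of_perturbed_pairs {ι : Type*} [DecidableEq ι] (β : Finset ι)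
    (w : ι → ι → ℝ) (hw : ∀ i ∈ β, ∀ j ∈ β, i ≠ j → w i j ≠ 0) (C : ℝ) :
    ∃ κ > 0, ∃ ε₀ > 0, ∀ ε : ℝ, 0 < ε → ε < ε₀ → ∀ v : ι → ℝ,
      (∀ i ∈ β, ∀ j ∈ β, i ≠ j →
        |w i j * v i + w j i * v j| ≤ ε * (C * ∑ k ∈ β, |v k|)) →
      (∀ i ∈ β, ∀ j ∈ β, κ * |v i| ≤ |v j|) ∧
      ((∃ i ∈ β, v i ≠ 0) → ∀ i ∈ β, ∀ j ∈ β, i ≠ j → w i j * v i * (w j i * v j) < 0) := by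
  obtain ⟨δ, hδ, hδw⟩ := exists_pos_le_of_finset β.offDiag (fun x => |w x.1 x.2|)
    (by rintro ⟨i, j⟩ h; simp only [mem_offDiag] at h; exact abs_pos.2 (hw i h.1 j h.2.1 h.2.2))
  obtain ⟨η, hη, hηw⟩ := exists_pos_le_of_finset β.offDiag
    (fun x => |w x.1 x.2| / (2 * |w x.2 x.1|))
    (by
      rintro ⟨i, j⟩ h
      simp only [mem_offDiag] at h
      have := abs_pos.2 (hw i h.1 j h.2.1 h.2.2)
      have := abs_pos.2 (hw j h.2.1 i h.1 (Ne.symm h.2.2))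
      positivity)
  -- `η` bounds half of every ratio of weights from below: the error will cost at most half of a
  -- main term.
  set κ := min 1 η with hκ
  have hκ0 : 0 < κ := lt_min one_pos hη
  set D := |C| * #β + 1 with hD
  have hD0 : 0 < D := by positivity
  refine ⟨κ, hκ0, δ / 2 * κ / D, by positivity, fun ε hε hε' v hv => ?_⟩
  have hκ1 : κ ≤ 1 := min_le_left _ _
  have hεD : ε * D < δ / 2 * κ := by rwa [lt_div_iff₀ hD0] at hε'
  rcases β.eq_empty_or_nonempty with rfl | hne
  · simp
  -- All errors are measured against the largest entry, which bounds each of them by `ε * D * |v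
  -- i|`.
  obtain ⟨i, hi, himax⟩ := exists_max_image β (fun k => |v k|) hne
  have hbound : ∀ a ∈ β, ∀ b ∈ β, a ≠ b → |w a b * v a + w b a * v b| ≤ ε * D * |v i| := by
    intro a ha b hb hab
    refine (hv a ha b hb hab).trans ?_
    rw [mul_assoc]
    refine mul_le_mul_of_nonneg_left ?_ hε.le
    have h1 : ∑ k ∈ β, |v k| ≤ #β * |v i| := by
      rw [← nsmul_eq_mul]; exact sum_le_card_nsmul _ _ _ himax
    calc C * ∑ k ∈ β, |v k| ≤ |C| * ∑ k ∈ β, |v k| :=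
          mul_le_mul_of_nonneg_right (le_abs_self C) (sum_nonneg fun _ _ => abs_nonneg _)
      _ ≤ |C| * (#β * |v i|) := mul_le_mul_of_nonneg_left h1 (abs_nonneg C)
      _ ≤ D * |v i| := by rw [hD]; nlinarith [abs_nonneg (v i)]
  have hvi := abs_nonneg (v i)
  have hcomp : ∀ j ∈ β, κ * |v i| ≤ |v j| := by
    intro j hj
    by_cases hij : i = j
    · subst hij; nlinarith
    have hb := hbound i hi j hj hij
    have hw1 := hδw (i, j) (by simp [hi, hj, hij])
    have hw2 := hηw (i, j) (by simp [hi, hj, hij])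
    simp only at hw1 hw2
    have hpos := abs_pos.2 (hw j hj i hi (Ne.symm hij))
    have h3 : |w i j| * |v i| ≤ |w j i| * |v j| + ε * D * |v i| := by
      rw [← abs_mul, ← abs_mul]
      have := abs_sub_abs_le_abs_sub (w i j * v i) (-(w j i * v j))
      rw [abs_neg, sub_neg_eq_add] at this
      linarith
    have h4 : ε * D * |v i| ≤ |w i j| / 2 * |v i| := by
      refine mul_le_mul_of_nonneg_right ?_ hvi
      nlinarith
    have h5 : |w i j| / (2 * |w j i|) * |v i| ≤ |v j| := by
      rw [div_mul_eq_mul_div, div_le_iff₀ (by positivity)]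
      nlinarith
    exact (mul_le_mul_of_nonneg_right ((min_le_right _ _).trans hw2) hvi).trans h5
  refine ⟨fun a ha b hb => ?_, fun ⟨a, ha, hva⟩ a' ha' b hb hab => ?_⟩
  · exact (mul_le_mul_of_nonneg_left (himax a ha) hκ0.le).trans (hcomp b hb)
  · have hvi0 : 0 < |v i| := (abs_pos.2 hva).trans_le (himax a ha)
    -- If the two terms do not have opposite signs, nothing cancels in their sum, so the first term
    -- alone is at most the error, below `δ * κ * |v i| / 2`.
    by_contra hcon
    have h1 : |w a' b * v a'| ≤ |w a' b * v a' + w b a' * v b| := by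
      rw [← sq_le_sq]
      nlinarith [sq_nonneg (w b a' * v b)]
    have h2 := hδw (a', b) (by simp [ha', hb, hab])
    simp only at h2
    have h3 := h1.trans (hbound a' ha' b hb hab)
    rw [abs_mul] at h3
    have h4 := hcomp a' ha'
    have h5 : δ * (κ * |v i|) ≤ |w a' b| * |v a'| := mul_le_mul h2 h4 (by positivity) (abs_nonneg _)
    have h6 : ε * D * |v i| < δ / 2 * κ * |v i| := mul_lt_mul_of_pos_right hεD hvi0
    have : 0 < δ * κ * |v i| := by positivity
    nlinarith

/-! ### Dependencies of truncated rows: the entries above the first gap -/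

section
/-- The coefficient of `x q` in the lower part of the `i`-th inequality of the deformed cube. -/
noncomputable def lowerCoeff (i q : ℕ) : ℝ :=
  if q < i then (-1) ^ (i + 1) * ((i - 1).choose q : ℝ) else 0

/-- `v` is supported on `S` and is a linear dependency of the rows of the deformed cube with signs
`σ`, truncated to their first `m` entries. -/
def IsDependency (ε : ℝ) (m : ℕ) (S : Finset ℕ) (σ v : ℕ → ℝ) : Prop :=
  (∀ i ∉ S, v i = 0) ∧ ∀ q < m, ε * (σ q * v q) + ∑ i ∈ S, v i * lowerCoeff i q = 0

variable {ε : ℝ} {m : ℕ} {S : Finset ℕ} {σ v : ℕ → ℝ}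

/-- Pairing a dependency with a polynomial. -/
theorem IsDependency.pairing (h : IsDependency ε m S σ v) {Z : Finset ℕ} {c : ℕ → ℝ}
    (hc : ∀ N : ℕ, ∏ z ∈ Z, (((N + 1 : ℕ) : ℝ) - z) = ∑ q ∈ range m, c q * (N.choose q : ℝ)) :
    ε * ∑ q ∈ range m, c q * (σ q * v q) +
      ∑ i ∈ S, (if i = 0 then 0 else v i * ((-1) ^ (i + 1) * ∏ z ∈ Z, ((i : ℝ) - z))) = 0 := by
  have h1 : ∑ q ∈ range m, c q * (ε * (σ q * v q) + ∑ i ∈ S, v i * lowerCoeff i q) = 0 :=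
    sum_eq_zero fun q hq => by rw [h.2 q (by simpa using hq), mul_zero]
  refine Eq.trans ?_ h1
  simp only [mul_add, sum_add_distrib, mul_sum]
  congr 1
  · exact sum_congr rfl fun q _ => by ring
  · rw [sum_comm]
    refine sum_congr rfl fun i _ => ?_
    -- Row 0 has no lower part. For the other rows the binomials are in `i - 1`, so `f` is evaluated
    -- at `i` through its expansion at `N + 1`.
    rcases i with _ | N
    · simp [lowerCoeff]
    · rw [if_neg (by omega), hc N, mul_sum, mul_sum]
      refine sum_congr rfl fun q _ => ?_
      simp only [lowerCoeff, Nat.add_sub_cancel]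
      split_ifs with hq
      · ring
      · rw [Nat.choose_eq_zero_of_lt (by omega)]; simp

/-- Controls the `ε`-term of a pairing by the entries in `β` alone: outside `β` either the Newton
coefficient or the entry is zero. -/
theorem abs_sum_le_of_support {β : Finset ℕ} {c : ℕ → ℝ} (hσ : ∀ q, |σ q| ≤ 1)
    (h : ∀ q < m, q ∉ β → c q * v q = 0) :
    |∑ q ∈ range m, c q * (σ q * v q)| ≤ (∑ q ∈ range m, |c q|) * ∑ k ∈ β, |v k| := by
  refine (abs_sum_le_sum_abs _ _).trans ?_
  rw [sum_mul]
  refine sum_le_sum fun q hq => ?_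
  by_cases hqβ : q ∈ β
  · rw [abs_mul, abs_mul]
    refine mul_le_mul_of_nonneg_left ?_ (abs_nonneg _)
    calc |σ q| * |v q| ≤ 1 * |v q| := mul_le_mul_of_nonneg_right (hσ q) (abs_nonneg _)
      _ = |v q| := one_mul _
      _ ≤ _ := single_le_sum (f := fun k => |v k|) (fun _ _ => abs_nonneg _) hqβ
  · rw [show c q * (σ q * v q) = σ q * (c q * v q) by ring, h q (by simpa using hq) hqβ]
    simp only [mul_zero, abs_zero]
    exact mul_nonneg (abs_nonneg _) (sum_nonneg fun _ _ => abs_nonneg _)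

/-- The elements of `S` above its initial segment: `p` is the first missing number. -/
def upperPart (S : Finset ℕ) (p : ℕ) : Finset ℕ := {i ∈ S | p < i}

theorem mem_upperPart {p i : ℕ} : i ∈ upperPart S p ↔ i ∈ S ∧ p < i := by simp [upperPart]

theorem card_upperPart {p : ℕ} (hr : range p ⊆ S) (hp : p ∉ S) : #(upperPart S p) + p = #S := by
  have h1 : S = upperPart S p ∪ range p := by
    ext i
    simp only [mem_union, mem_upperPart, mem_range]
    constructor
    · intro hi
      rcases lt_trichotomy i p with h | rfl | h
      · exact Or.inr h
      · exact absurd hi hp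
      · exact Or.inl ⟨hi, h⟩
    · rintro (h | h)
      · exact h.1
      · exact hr (by simpa using h)
  conv_rhs => rw [h1]
  rw [card_union_of_disjoint, card_range]
  rw [disjoint_left]
  intro i hi
  simp only [mem_upperPart] at hi
  simp; omega

/-- The pairing with a polynomial that vanishes on `1, …, p` and on the upper indices other than `i`
and `j` leaves a two-term relation with an `O(ε)` error. The sign of the product of the two weights
is given by `i + j` and the number of zeros between them. -/
theorem upper_block (m : ℕ) (S : Finset ℕ) (p : ℕ) (hr : range p ⊆ S) (hp : p ∉ S)
    (hS : #S = m + 1) :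
    ∃ κ > 0, ∃ ε₀ > 0, ∀ ε : ℝ, 0 < ε → ε < ε₀ → ∀ σ v : ℕ → ℝ, (∀ i, |σ i| ≤ 1) →
      IsDependency ε m S σ v →
      (∀ i ∈ upperPart S p, ∀ j ∈ upperPart S p, κ * |v i| ≤ |v j|) ∧
      ((∃ i ∈ upperPart S p, v i ≠ 0) → ∀ i ∈ upperPart S p, ∀ j ∈ upperPart S p, i < j →
        (-1) ^ (i + j + #{k ∈ upperPart S p | i < k ∧ k < j}) * (v i * v j) < 0) := by
  classical
  set β := upperPart S p with hβ
  have hcard : #β + p = m + 1 := by rw [hβ, card_upperPart hr hp, hS]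
  have hβp : ∀ i ∈ β, p < i := fun i hi => (mem_upperPart.1 hi).2
  -- The degree is `p + #β - 2 = m - 1`. The zero at `p`, although `p ∉ S`, makes the coefficient `c
  -- (p - 1)` vanish, so no entry of the initial segment enters the error.
  set Z : ℕ → ℕ → Finset ℕ := fun i j => Icc 1 p ∪ (β.erase i).erase j with hZ
  have hZsymm : ∀ i j, Z i j = Z j i := fun i j => by simp only [hZ, erase_right_comm]
  have hZi : ∀ i ∈ β, ∀ j, i ∉ Z i j := fun i hi j => by
    have := hβp i hi
    simp only [hZ, mem_union, mem_Icc, mem_erase, not_or]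
    exact ⟨by omega, by simp⟩
  have hZc : ∀ i ∈ β, ∀ j ∈ β, i ≠ j → #(Z i j) < m := fun i hi j hj hij => by
    have h1 : #((β.erase i).erase j) = #β - 1 - 1 := by
      rw [card_erase_of_mem (by simp [hj, hij.symm]), card_erase_of_mem hi]
    have h2 : 1 < #β := one_lt_card.2 ⟨i, hi, j, hj, hij⟩
    have h3 := card_union_le (Icc 1 p) ((β.erase i).erase j)
    rw [Nat.card_Icc] at h3
    simp only [hZ]
    omega
  choose! c hc hc0 using fun (i : ℕ) (hi : i ∈ β) (j : ℕ) (hj : j ∈ β) (hij : i ≠ j) =>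
    exists_newton_coeff (Z i j) (hZc i hi j hj hij)
  set w : ℕ → ℕ → ℝ := fun i j => (-1) ^ (i + 1) * ∏ z ∈ Z i j, ((i : ℝ) - z) with hw
  have hwpos : ∀ i ∈ β, ∀ j, 0 < (-1) ^ (i + 1 + #{z ∈ Z i j | i < z}) * w i j := fun i hi j => by
    have := neg_one_pow_mul_prod_sub_pos (Z i j) i (hZi i hi j)
    rw [hw, pow_add]
    have h2 : ((-1 : ℝ) ^ (i + 1)) * (-1) ^ (i + 1) = 1 := by
      rw [← pow_add]; exact Even.neg_one_pow ⟨_, rfl⟩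
    refine this.trans_eq ?_
    linear_combination (-((-1) ^ #{z ∈ Z i j | i < z} * ∏ z ∈ Z i j, ((i : ℝ) - z))) * h2
  set C := ∑ i ∈ β, ∑ j ∈ β, ∑ q ∈ range m, |c i j q| with hC
  obtain ⟨κ, hκ, ε₀, hε₀, H⟩ := exists_comparable_of_perturbed_pairs β w
    (fun i hi j _ _ h => by have := hwpos i hi j; rw [h, mul_zero] at this; exact lt_irrefl _ this) C
  refine ⟨κ, hκ, ε₀, hε₀, fun ε hε hε' σ v hσ hv => ?_⟩
  obtain ⟨H1, H2⟩ := H ε hε hε' v fun i hi j hj hij => by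
    have e := hv.pairing (hc i hi j hj hij)
    have e2 : ∑ k ∈ S, (if k = 0 then 0 else
        v k * ((-1) ^ (k + 1) * ∏ z ∈ Z i j, ((k : ℝ) - z))) = w i j * v i + w j i * v j := by
      have hsub : ({i, j} : Finset ℕ) ⊆ S := by
        intro k hk
        simp only [mem_insert, mem_singleton] at hk
        rcases hk with rfl | rfl
        · exact (mem_upperPart.1 hi).1
        · exact (mem_upperPart.1 hj).1
      rw [← sum_subset hsub, sum_pair hij, if_neg (by have := hβp i hi; omega),
        if_neg (by have := hβp j hj; omega), hw]
      · simp only [hZsymm j i]; ring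
      · intro k hk hk2
        simp only [mem_insert, mem_singleton, not_or] at hk2
        split_ifs with hk0
        · rfl
        · have : k ∈ Z i j := by
            simp only [hZ, mem_union, mem_Icc, mem_erase]
            rcases lt_trichotomy k p with h | rfl | h
            · left; omega
            · exact absurd hk hp
            · exact Or.inr ⟨hk2.2, hk2.1, mem_upperPart.2 ⟨hk, h⟩⟩
          rw [prod_eq_zero this (sub_self _), mul_zero, mul_zero]
    rw [e2] at e
    rw [show w i j * v i + w j i * v j = -(ε * ∑ q ∈ range m, c i j q * (σ q * v q)) by linarith,
      abs_neg, abs_mul, abs_of_pos hε]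
    refine mul_le_mul_of_nonneg_left ?_ hε.le
    refine (abs_sum_le_of_support (β := β) hσ ?_).trans ?_
    · intro q _ hq
      rcases lt_trichotomy q p with h | rfl | h
      · rw [hc0 i hi j hj hij q, zero_mul]
        intro a ha
        simp only [hZ, mem_union, mem_Icc] at ha ⊢
        left; omega
      · rw [hv.1 q hp, mul_zero]
      · rw [hv.1 q fun hqS => hq (mem_upperPart.2 ⟨hqS, h⟩), mul_zero]
    · refine mul_le_mul_of_nonneg_right ?_ (sum_nonneg fun _ _ => abs_nonneg _)
      have h0 : ∀ a b, 0 ≤ ∑ q ∈ range m, |c a b q| := fun a b => sum_nonneg fun _ _ => abs_nonneg _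
      calc _ ≤ ∑ j ∈ β, ∑ q ∈ range m, |c i j q| :=
            single_le_sum (f := fun j => ∑ q ∈ range m, |c i j q|) (fun _ _ => h0 _ _) hj
        _ ≤ C := single_le_sum (f := fun i => ∑ j ∈ β, ∑ q ∈ range m, |c i j q|)
            (fun _ _ => sum_nonneg fun _ _ => h0 _ _) hi
  refine ⟨H1, fun hne i hi j hj hij => ?_⟩
  have h1 := H2 hne i hi j hj hij.ne
  have h2 := hwpos i hi j
  have h3 := hwpos j hj i
  -- The zeros above `j` contribute to both weights and cancel modulo 2; only those between `i` and
  -- `j` count.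
  have hcnt : #{z ∈ Z i j | i < z} = #{z ∈ Z j i | j < z} + #{k ∈ β | i < k ∧ k < j} := by
    rw [hZsymm j i, ← card_union_of_disjoint]
    · congr 1
      ext z
      have := hβp i hi
      simp only [hZ, mem_union, mem_filter, mem_Icc, mem_erase]
      constructor
      · rintro ⟨hz | hz, hiz⟩
        · omega
        · rcases lt_or_gt_of_ne hz.1 with h | h
          · exact Or.inr ⟨hz.2.2, hiz, h⟩
          · exact Or.inl ⟨Or.inr hz, h⟩
      · rintro (⟨hz | hz, hjz⟩ | ⟨hz, h⟩)
        · exact ⟨Or.inl hz, by omega⟩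
        · exact ⟨Or.inr hz, by omega⟩
        · exact ⟨Or.inr ⟨by omega, by omega, hz⟩, by omega⟩
    · rw [disjoint_left]
      intro z hz
      simp only [mem_filter] at hz ⊢
      omega
  rw [hcnt] at h2
  set A := #{z ∈ Z j i | j < z}
  set B := #{k ∈ β | i < k ∧ k < j}
  have h4 := mul_pos h2 h3
  have h5 : ((-1 : ℝ) ^ (i + 1 + (A + B)) * w i j) * ((-1) ^ (j + 1 + A) * w j i) =
      (-1) ^ (i + j + B) * (w i j * w j i) := by
    have e : (-1 : ℝ) ^ (i + 1 + (A + B)) * (-1) ^ (j + 1 + A) = (-1) ^ (i + j + B) := by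
      rw [← pow_add, show i + 1 + (A + B) + (j + 1 + A) = i + j + B + 2 * (A + 1) by ring, pow_add,
        pow_mul]
      simp
    rw [← e]; ring
  rw [h5] at h4
  have h6 : (-1 : ℝ) ^ (i + j + B) * (-1) ^ (i + j + B) = 1 := by
    rw [← pow_add]; exact Even.neg_one_pow ⟨_, rfl⟩
  by_contra hcon
  push Not at hcon
  have h7 := mul_nonneg h4.le hcon
  have : ((-1 : ℝ) ^ (i + j + B) * (w i j * w j i)) * ((-1) ^ (i + j + B) * (v i * v j)) =
      w i j * v i * (w j i * v j) := by
    linear_combination (w i j * w j i * v i * v j) * h6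
  linarith

end

/-! ### Dependencies of truncated rows: the initial segment and the whole sign pattern -/

section
variable {ε : ℝ} {m : ℕ} {S : Finset ℕ} {σ v : ℕ → ℝ}

theorem mul_pos_and_le_abs_of_abs_sub_le {x y : ℝ} (hy : y ≠ 0) (h : |x - y| ≤ |y| / 2) :
    0 < x * y ∧ |y| / 2 ≤ |x| := by
  have hy' := abs_pos.2 hy
  rcases abs_cases y with ⟨e, h0⟩ | ⟨e, h0⟩ <;> rcases abs_le.1 h with ⟨h1, h2⟩ <;>
    rw [e] at h1 h2 hy' ⊢
  · have : 0 < x := by linarith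
    exact ⟨mul_pos this (by linarith), by rw [abs_of_pos this]; linarith⟩
  · have : x < 0 := by linarith
    exact ⟨mul_pos_of_neg_of_neg this (by linarith), by rw [abs_of_neg this]; linarith⟩

/-- The last entry of an initial segment dominates the entries above the gap. -/
theorem last_initial_entry (m : ℕ) (S : Finset ℕ) (r b : ℕ) (hr : range (r + 1) ⊆ S)
    (hp : r + 1 ∉ S) (hS : #S = m + 1) (hb : b ∈ upperPart S (r + 1))
    (hmin : ∀ k ∈ upperPart S (r + 1), b ≤ k) (κ K : ℝ) (hκ : 0 < κ) (hK : 0 < K) :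
    ∃ ε₀ > 0, ∀ ε : ℝ, 0 < ε → ε < ε₀ → ∀ σ v : ℕ → ℝ, (∀ i, |σ i| = 1) →
      IsDependency ε m S σ v → (∀ j ∈ upperPart S (r + 1), κ * |v j| ≤ |v b|) → v b ≠ 0 →
      K * |v b| ≤ |v r| ∧ 0 < (-1) ^ b * (σ r * (v r * v b)) := by
  classical
  have hcard := card_upperPart hr hp
  set β := upperPart S (r + 1) with hβ
  have hβp : ∀ i ∈ β, r + 1 < i := fun i hi => (mem_upperPart.1 hi).2
  -- Here the missing index `r + 1` is not a zero. Hence the first Newton coefficient that can be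
  -- nonzero is `c r = f (r + 1)`, and `v r` occurs in the `ε`-term against the single surviving row
  -- `b`.
  set Z : Finset ℕ := Icc 1 r ∪ β.erase b with hZ
  have hβ1 : 1 ≤ #β := card_pos.2 ⟨b, hb⟩
  have hZc : #Z < m := by
    have h3 := card_union_le (Icc 1 r) (β.erase b)
    rw [← hZ, Nat.card_Icc, card_erase_of_mem hb] at h3
    omega
  obtain ⟨c, hc, hc0⟩ := exists_newton_coeff Z hZc
  set f₀ := ∏ z ∈ Z, (((r + 1 : ℕ) : ℝ) - z) with hf₀
  set f₁ := ∏ z ∈ Z, ((b : ℝ) - z) with hf₁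
  have hc0' : ∀ q < r, c q = 0 := fun q hq => hc0 q fun a ha => by
    simp only [hZ, mem_union, mem_Icc] at ha ⊢
    left; omega
  have hcr : c r = f₀ := by
    rw [hf₀, hc r, sum_eq_single_of_mem r (by simp; omega)]
    · simp
    · intro q _ hq
      rcases lt_or_gt_of_ne hq with h | h
      · rw [hc0' q h, zero_mul]
      · rw [Nat.choose_eq_zero_of_lt h]; simp
  have hf : 0 < f₀ * f₁ := by
    have h1 := neg_one_pow_mul_prod_sub_pos Z (r + 1) (by
      simp only [hZ, mem_union, mem_Icc, mem_erase, not_or]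
      exact ⟨by omega, fun h => by have := hβp _ h.2; omega⟩)
    have h2 := neg_one_pow_mul_prod_sub_pos Z b (by
      have := hβp b hb
      simp only [hZ, mem_union, mem_Icc, mem_erase, not_or]
      exact ⟨by omega, by simp⟩)
    -- Since `b` is the least upper index, no zero lies between `r + 1` and `b`, so `f` has the same
    -- sign at both.
    have e : #{z ∈ Z | r + 1 < z} = #{z ∈ Z | b < z} := by
      congr 1
      ext z
      have := hβp b hb
      simp only [hZ, mem_union, mem_filter, mem_Icc, mem_erase]
      constructor
      · rintro ⟨hz | hz, h⟩
        · omega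
        · have := hmin z hz.2
          exact ⟨Or.inr hz, by omega⟩
      · rintro ⟨hz, h⟩
        exact ⟨hz, by omega⟩
    rw [e] at h1
    have h3 := mul_pos h1 h2
    have h6 : (-1 : ℝ) ^ #{z ∈ Z | b < z} * (-1) ^ #{z ∈ Z | b < z} = 1 := by
      rw [← pow_add]; exact Even.neg_one_pow ⟨_, rfl⟩
    refine h3.trans_eq ?_
    linear_combination (f₀ * f₁) * h6
  have hf₀0 : f₀ ≠ 0 := left_ne_zero_of_mul hf.ne'
  have hf₁0 : f₁ ≠ 0 := right_ne_zero_of_mul hf.ne'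
  set c' : ℕ → ℝ := fun q => if q = r then 0 else c q with hc'
  set D := (∑ q ∈ range m, |c' q|) * (#β / κ) + 1 with hD
  have hD0 : 0 < D := by positivity
  -- The first bound keeps the remaining `ε`-terms below half of `|f₁ v_b|`; the second turns `ε |f₀
  -- v_r| ≥ |f₁ v_b| / 2` into domination by the factor `K`.
  refine ⟨min (|f₁| / 2 / D) (|f₁| / 2 / (K * |f₀|)), by positivity,
    fun ε hε hε' σ v hσ hv hcomp hvb => ?_⟩
  have hε1 := hε'.trans_le (min_le_left _ _)
  have hε2 := hε'.trans_le (min_le_right _ _)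
  rw [lt_div_iff₀ hD0] at hε1
  rw [lt_div_iff₀ (by positivity)] at hε2
  have e := hv.pairing hc
  have e2 : ∑ k ∈ S, (if k = 0 then 0 else
      v k * ((-1) ^ (k + 1) * ∏ z ∈ Z, ((k : ℝ) - z))) = v b * ((-1) ^ (b + 1) * f₁) := by
    rw [sum_eq_single_of_mem b (mem_upperPart.1 hb).1, if_neg (by have := hβp b hb; omega)]
    intro k hk hk2
    split_ifs with hk0
    · rfl
    · by_cases hkr : k = r + 1
      · exact absurd hk (hkr ▸ hp)
      · have : k ∈ Z := by
          simp only [hZ, mem_union, mem_Icc, mem_erase]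
          by_cases h : k ≤ r
          · left; omega
          · exact Or.inr ⟨hk2, mem_upperPart.2 ⟨hk, by omega⟩⟩
        rw [prod_eq_zero this (sub_self _), mul_zero, mul_zero]
  have e3 : ∑ q ∈ range m, c q * (σ q * v q) =
      f₀ * (σ r * v r) + ∑ q ∈ range m, c' q * (σ q * v q) := by
    have hrm : r ∈ range m := by simp; omega
    rw [← add_sum_erase _ _ hrm, ← add_sum_erase (range m) (fun q => c' q * (σ q * v q)) hrm, hcr]
    simp only [hc', if_true, zero_mul, zero_add]
    congr 1
    exact sum_congr rfl fun q hq => by rw [if_neg (mem_erase.1 hq).1]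
  have hR : |∑ q ∈ range m, c' q * (σ q * v q)| ≤ D * |v b| := by
    refine (abs_sum_le_of_support (β := β) (fun q => (hσ q).le) ?_).trans ?_
    · intro q _ hq
      simp only [hc']
      split_ifs with h
      · exact zero_mul _
      · rcases lt_or_gt_of_ne h with h | h
        · rw [hc0' q h, zero_mul]
        · rw [hv.1 q, mul_zero]
          intro hqS
          rcases eq_or_ne q (r + 1) with rfl | h'
          · exact hp hqS
          · exact hq (mem_upperPart.2 ⟨hqS, by omega⟩)
    · have h1 : ∑ k ∈ β, |v k| ≤ #β / κ * |v b| := by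
        calc _ ≤ #β • (|v b| / κ) := sum_le_card_nsmul _ _ _ fun k hk => by
              rw [le_div_iff₀ hκ, mul_comm]; exact hcomp k hk
          _ = _ := by rw [nsmul_eq_mul]; ring
      calc _ ≤ (∑ q ∈ range m, |c' q|) * (#β / κ * |v b|) :=
            mul_le_mul_of_nonneg_left h1 (sum_nonneg fun _ _ => abs_nonneg _)
        _ ≤ _ := by rw [hD]; nlinarith [abs_nonneg (v b)]
  rw [e2, e3] at e
  have hpow : |(-1 : ℝ) ^ b| = 1 := by simp
  have hY : |(-1) ^ b * (f₁ * v b)| = |f₁| * |v b| := by rw [abs_mul, hpow, one_mul, abs_mul]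
  obtain ⟨h1, h2⟩ := mul_pos_and_le_abs_of_abs_sub_le (x := ε * (f₀ * (σ r * v r)))
    (y := (-1) ^ b * (f₁ * v b)) (by positivity) (by
      rw [show ε * (f₀ * (σ r * v r)) - (-1) ^ b * (f₁ * v b) =
        -(ε * ∑ q ∈ range m, c' q * (σ q * v q)) by rw [pow_succ] at e; linear_combination e,
        abs_neg, abs_mul, abs_of_pos hε, hY]
      calc _ ≤ ε * (D * |v b|) := mul_le_mul_of_nonneg_left hR hε.le
        _ ≤ _ := by nlinarith [abs_nonneg (v b)])
  rw [hY, abs_mul, abs_mul, abs_mul, hσ, abs_of_pos hε, one_mul] at h2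
  constructor
  · have h3 : ε * (K * |f₀|) * |v b| ≤ |f₁| / 2 * |v b| :=
      mul_le_mul_of_nonneg_right hε2.le (abs_nonneg _)
    have h4 : (ε * |f₀|) * (K * |v b|) ≤ (ε * |f₀|) * |v r| := by linarith
    exact le_of_mul_le_mul_left h4 (by positivity)
  · have h3 : ε * (f₀ * (σ r * v r)) * ((-1) ^ b * (f₁ * v b)) =
      ε * (f₀ * f₁) * ((-1) ^ b * (σ r * (v r * v b))) := by ring
    rw [h3] at h1
    exact pos_of_mul_pos_right h1 (by positivity)

theorem abs_lowerCoeff_le {i q n : ℕ} (hi : i ≤ n) : |lowerCoeff i q| ≤ 2 ^ n := by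
  unfold lowerCoeff
  split_ifs
  · rw [abs_mul]
    simp only [abs_pow, abs_neg, abs_one, one_pow, one_mul, Nat.abs_cast]
    calc (((i - 1).choose q : ℕ) : ℝ) ≤ ((2 ^ (i - 1) : ℕ) : ℝ) :=
          by exact_mod_cast Nat.choose_le_two_pow _ _
      _ = 2 ^ (i - 1) := by push_cast; rfl
      _ ≤ 2 ^ n := pow_le_pow_right₀ one_le_two (by omega)
  · simp

/-- Within the initial segment every entry dominates all later ones. -/
theorem initial_entry_step {n q : ℕ} {K : ℝ} (hSn : S ⊆ range n) (hq1 : q + 1 ∈ S) (hqm : q < m)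
    (hK : K = 2 ^ (n + 1) * (n + 1)) (hε : 0 < ε) (hε' : ε < 1 / (2 * K)) (hσ : ∀ i, |σ i| = 1)
    (hv : IsDependency ε m S σ v) (hdom : ∀ k ∈ S, q + 1 < k → K * |v k| ≤ |v (q + 1)|)
    (h0 : v (q + 1) ≠ 0) :
    (∀ k ∈ S, q < k → K * |v k| ≤ |v q|) ∧ 0 < (-1) ^ (q + 1) * (σ q * (v q * v (q + 1))) := by
  have hK1 : 1 ≤ K := by
    rw [hK]
    have : (1 : ℝ) ≤ 2 ^ (n + 1) := one_le_pow₀ one_le_two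
    nlinarith [(Nat.cast_nonneg n : (0 : ℝ) ≤ n)]
  have e := hv.2 q hqm
  rw [← add_sum_erase _ _ hq1] at e
  have hl : lowerCoeff (q + 1) q = (-1) ^ q := by simp [lowerCoeff, pow_succ]
  -- This fixes `K`: there are at most `n` other terms, each at most `2 ^ n * |v (q + 1)| / K`.
  have hrest : |∑ i ∈ S.erase (q + 1), v i * lowerCoeff i q| ≤ |v (q + 1)| / 2 := by
    calc _ ≤ ∑ i ∈ S.erase (q + 1), |v i * lowerCoeff i q| := abs_sum_le_sum_abs _ _
      _ ≤ #(S.erase (q + 1)) • (|v (q + 1)| / K * 2 ^ n) := by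
          refine sum_le_card_nsmul _ _ _ fun i hi => ?_
          obtain ⟨hi1, hi2⟩ := mem_erase.1 hi
          by_cases hiq : q < i
          · rw [abs_mul]
            refine mul_le_mul ?_ (abs_lowerCoeff_le (by have := hSn hi2; simp at this; omega))
              (abs_nonneg _) (by positivity)
            rw [le_div_iff₀ (by linarith), mul_comm]
            exact hdom i hi2 (by omega)
          · simp only [lowerCoeff, if_neg hiq, mul_zero, abs_zero]
            positivity
      _ ≤ (n + 1) * (|v (q + 1)| / K * 2 ^ n) := by
          rw [nsmul_eq_mul]
          refine mul_le_mul_of_nonneg_right ?_ (by positivity)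
          have h1 : #(S.erase (q + 1)) ≤ n :=
            (card_le_card ((erase_subset _ _).trans hSn)).trans (card_range n).le
          have : ((#(S.erase (q + 1)) : ℕ) : ℝ) ≤ n := by exact_mod_cast h1
          linarith
      _ = _ := by
          rw [hK, pow_succ]
          field_simp
  have hpow : |(-1 : ℝ) ^ (q + 1)| = 1 := by simp
  have hY : |(-1) ^ (q + 1) * v (q + 1)| = |v (q + 1)| := by rw [abs_mul, hpow, one_mul]
  obtain ⟨h1, h2⟩ := mul_pos_and_le_abs_of_abs_sub_le (x := ε * (σ q * v q))
    (y := (-1) ^ (q + 1) * v (q + 1)) (by positivity) (by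
      rw [hY]
      refine le_trans (le_of_eq ?_) hrest
      rw [← abs_neg]
      congr 1
      rw [hl] at e
      rw [pow_succ]
      linear_combination -e)
  rw [hY, abs_mul, abs_mul, hσ, abs_of_pos hε, one_mul] at h2
  have h3 : K * |v (q + 1)| ≤ |v q| := by
    rw [lt_div_iff₀ (by linarith)] at hε'
    have h4 : ε * K * |v (q + 1)| ≤ 1 / 2 * |v (q + 1)| :=
      mul_le_mul_of_nonneg_right (by linarith) (abs_nonneg _)
    exact le_of_mul_le_mul_left (a := ε) (by linarith) hε
  constructor
  · intro k hk hqk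
    rcases eq_or_ne k (q + 1) with rfl | hne
    · exact h3
    · have h5 := hdom k hk (by omega)
      have h6 : |v (q + 1)| ≤ K * |v (q + 1)| := le_mul_of_one_le_left (abs_nonneg _) hK1
      linarith
  · have h4 : ε * (σ q * v q) * ((-1) ^ (q + 1) * v (q + 1)) =
      ε * ((-1) ^ (q + 1) * (σ q * (v q * v (q + 1)))) := by ring
    rw [h4] at h1
    exact pos_of_mul_pos_right h1 hε.le

/-- Equation `r` involves, besides `v r` itself, only later entries; once these vanish it reads `ε
σ_r v_r = 0`, and one descends. -/
theorem IsDependency.eq_zero_of_tail {r : ℕ} (hε : 0 < ε) (hσ : ∀ i, |σ i| = 1)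
    (hv : IsDependency ε m S σ v) (hr : r ≤ m) (h0 : ∀ k, r ≤ k → v k = 0) : v = 0 := by
  induction r with
  | zero => exact funext fun k => h0 k (Nat.zero_le k)
  | succ r ih =>
    refine ih (by omega) fun k hk => ?_
    rcases hk.lt_or_eq with h | rfl
    · exact h0 k h
    · have e := hv.2 r (by omega)
      rw [sum_eq_zero, add_zero] at e
      · have : σ r ≠ 0 := fun h => by have := hσ r; simp [h] at this
        simpa [hε.ne', this] using e
      · intro i _
        by_cases hi : r < i
        · rw [h0 i hi, zero_mul]
        · simp [lowerCoeff, hi]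

/-- The signs of the entries of a dependency supported on `S`, where `p` is the least number that
is missing in `S`. -/
structure SignPattern (S : Finset ℕ) (p : ℕ) (σ v : ℕ → ℝ) : Prop where
  ne_zero : ∀ i ∈ S, v i ≠ 0
  upper : ∀ i ∈ upperPart S p, ∀ j ∈ upperPart S p, i < j →
    (-1) ^ (i + j + #{k ∈ upperPart S p | i < k ∧ k < j}) * (v i * v j) < 0
  last : ∀ b ∈ upperPart S p, (∀ k ∈ upperPart S p, b ≤ k) → ∀ r, p = r + 1 →
    0 < (-1) ^ b * (σ r * (v r * v b))
  initial : ∀ q, q + 1 < p → 0 < (-1) ^ (q + 1) * (σ q * (v q * v (q + 1)))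

/-- Downward induction from `p - 1` with `initial_entry_step`; domination of all later entries is
the invariant. -/
theorem signPattern_of_dominated_tail {n p : ℕ} {K : ℝ} (hSn : S ⊆ range n) (hr : range p ⊆ S)
    (hpm : p ≤ m + 1) (hK : K = 2 ^ (n + 1) * (n + 1)) (hε : 0 < ε) (hε' : ε < 1 / (2 * K))
    (hσ : ∀ i, |σ i| = 1) (hv : IsDependency ε m S σ v)
    (hstart : ∀ r, p = r + 1 → v r ≠ 0 ∧ ∀ k ∈ S, r < k → K * |v k| ≤ |v r|) :
    ∀ q < p, v q ≠ 0 ∧ (q + 1 < p → 0 < (-1) ^ (q + 1) * (σ q * (v q * v (q + 1)))) := by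
  have key : ∀ t q, q + t + 1 = p → v q ≠ 0 ∧ (∀ k ∈ S, q < k → K * |v k| ≤ |v q|) ∧
      (q + 1 < p → 0 < (-1) ^ (q + 1) * (σ q * (v q * v (q + 1)))) := by
    intro t
    induction t with
    | zero =>
      intro q hq
      obtain ⟨h1, h2⟩ := hstart q hq.symm
      exact ⟨h1, h2, fun h => by omega⟩
    | succ t ih =>
      intro q hq
      obtain ⟨h1, h2, _⟩ := ih (q + 1) (by omega)
      obtain ⟨h3, h4⟩ := initial_entry_step hSn (hr (by simp; omega)) (by omega) hK hε hε' hσ hv h2 h1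
      refine ⟨fun h => ?_, h3, fun _ => h4⟩
      rw [h] at h4
      simp at h4
  intro q hq
  obtain ⟨h1, _, h2⟩ := key (p - q - 1) q (by omega)
  exact ⟨h1, h2⟩

/-- If nothing lies above the gap, then `p = m + 1` and the descent starts at `v m`. Otherwise the
comparable entries of the upper block control `v (p - 1)`, which starts the descent when `p > 0`. -/
theorem exists_signPattern (n m : ℕ) (S : Finset ℕ) (p : ℕ) (hSn : S ⊆ range n)
    (hS : #S = m + 1) (hr : range p ⊆ S) (hp : p ∉ S) :
    ∃ ε₀ > 0, ∀ ε : ℝ, 0 < ε → ε < ε₀ → ∀ σ v : ℕ → ℝ, (∀ i, |σ i| = 1) →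
      IsDependency ε m S σ v → v ≠ 0 → SignPattern S p σ v := by
  obtain ⟨κ, hκ, ε₁, hε₁, H1⟩ := upper_block m S p hr hp hS
  set K : ℝ := 2 ^ (n + 1) * (n + 1) with hK
  have hK0 : 0 < K := by positivity
  have hcard := card_upperPart hr hp
  have hmemS : ∀ i ∈ S, i < p ∨ i ∈ upperPart S p := fun i hi => by
    rcases lt_trichotomy i p with h | rfl | h
    · exact Or.inl h
    · exact absurd hi hp
    · exact Or.inr (mem_upperPart.2 ⟨hi, h⟩)
  rcases (upperPart S p).eq_empty_or_nonempty with he | hne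
  · rw [he, card_empty] at hcard
    refine ⟨1 / (2 * K), by positivity, fun ε hε hε' σ v hσ hv hv0 => ?_⟩
    have key := signPattern_of_dominated_tail hSn hr (by omega) hK hε hε' hσ hv (fun r hpr => by
      have hk : ∀ k ∈ S, ¬ r < k := fun k hk hrk => by
        rcases hmemS k hk with h | h
        · omega
        · rw [he] at h; simp at h
      refine ⟨fun h0 => hv0 ?_, fun k hkS hrk => absurd hrk (hk k hkS)⟩
      refine hv.eq_zero_of_tail hε hσ (r := r) (by omega) fun k hrk => ?_
      rcases hrk.lt_or_eq with h | rfl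
      · exact hv.1 k fun hkS => hk k hkS h
      · exact h0)
    refine ⟨fun i hi => ?_, ?_, ?_, fun q hq => (key q (by omega)).2 hq⟩
    · rcases hmemS i hi with h | h
      · exact (key i h).1
      · rw [he] at h; simp at h
    · simp [he]
    · simp [he]
  · have hpos := card_pos.2 hne
    set b := (upperPart S p).min' hne with hb
    have hbm : b ∈ upperPart S p := min'_mem _ _
    have hbmin : ∀ k ∈ upperPart S p, b ≤ k := fun k hk => min'_le _ _ hk
    have hlast : ∃ ε₂ > 0, ∀ ε : ℝ, 0 < ε → ε < ε₂ → ∀ σ v : ℕ → ℝ, (∀ i, |σ i| = 1) →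
        IsDependency ε m S σ v → (∀ j ∈ upperPart S p, κ * |v j| ≤ |v b|) → v b ≠ 0 →
        -- The factor `K / κ` makes `v r` dominate every upper entry by `K`, since `κ * |v k| ≤ |v
        -- b|`.
        ∀ r, p = r + 1 → K / κ * |v b| ≤ |v r| ∧ 0 < (-1) ^ b * (σ r * (v r * v b)) := by
      rcases p with _ | r
      · exact ⟨1, one_pos, fun _ _ _ _ _ _ _ _ _ r h => by omega⟩
      · obtain ⟨ε₂, h2, H2⟩ := last_initial_entry m S r b hr hp hS hbm hbmin κ (K / κ) hκ
          (by positivity)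
        refine ⟨ε₂, h2, fun ε hε hε' σ v hσ hv hc hb0 r' hr' => ?_⟩
        obtain rfl : r = r' := by omega
        exact H2 ε hε hε' σ v hσ hv hc hb0
    obtain ⟨ε₂, hε₂, H2⟩ := hlast
    refine ⟨min (min ε₁ ε₂) (1 / (2 * K)), by positivity, fun ε hε hε' σ v hσ hv hv0 => ?_⟩
    have h3 := hε'.trans_le (min_le_right _ _)
    have h12 := hε'.trans_le (min_le_left _ _)
    obtain ⟨A1, A2⟩ := H1 ε hε (h12.trans_le (min_le_left _ _)) σ v (fun i => (hσ i).le) hv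
    have hex : ∃ i ∈ upperPart S p, v i ≠ 0 := by
      by_contra hcon
      push Not at hcon
      refine hv0 (hv.eq_zero_of_tail hε hσ (r := p) (by omega) fun k hk => ?_)
      by_cases hkS : k ∈ S
      · rcases hmemS k hkS with h | h
        · omega
        · exact hcon k h
      · exact hv.1 k hkS
    have hne0 : ∀ j ∈ upperPart S p, v j ≠ 0 := fun j hj h0 => by
      obtain ⟨i, hi, hvi⟩ := hex
      have := A1 i hi j hj
      rw [h0, abs_zero] at this
      have : 0 < κ * |v i| := by positivity
      linarith
    have B := H2 ε hε (h12.trans_le (min_le_right _ _)) σ v hσ hv (fun j hj => A1 j hj b hbm)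
      (hne0 b hbm)
    have key := signPattern_of_dominated_tail hSn hr (by omega) hK hε h3 hσ hv (fun r hpr => by
      obtain ⟨B1, B2⟩ := B r hpr
      refine ⟨fun h0 => by rw [h0] at B2; simp at B2, fun k hkS hrk => ?_⟩
      have hk : k ∈ upperPart S p := by
        rcases hmemS k hkS with h | h
        · omega
        · exact h
      have h5 := mul_le_mul_of_nonneg_left (A1 k hk b hbm) (show 0 ≤ K / κ by positivity)
      have h6 : K / κ * (κ * |v k|) = K * |v k| := by field_simp
      linarith)
    refine ⟨fun i hi => ?_, A2 hex, fun b' hb' hmin' r hpr => ?_, fun q hq => (key q (by omega)).2 hq⟩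
    · rcases hmemS i hi with h | h
      · exact (key i h).1
      · exact hne0 i h
    · have : b' = b := le_antisymm (hmin' b hbm) (hbmin b' hb')
      rw [this]
      exact (B r hpr).2

/-- For all small `ε` every nonzero dependency of `m + 1` rows has the expected signs. -/
theorem exists_forall_signPattern (n m : ℕ) :
    ∃ ε₀ > 0, ∀ ε : ℝ, 0 < ε → ε < ε₀ → ∀ S ⊆ range n, #S = m + 1 → ∀ p, range p ⊆ S → p ∉ S →
      ∀ σ v : ℕ → ℝ, (∀ i, |σ i| = 1) → IsDependency ε m S σ v → v ≠ 0 → SignPattern S p σ v := by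
  classical
  set I : Finset (Finset ℕ × ℕ) := {x ∈ (range n).powerset ×ˢ range (m + 2) |
    #x.1 = m + 1 ∧ range x.2 ⊆ x.1 ∧ x.2 ∉ x.1} with hI
  choose! f hf0 hf using fun (x : Finset ℕ × ℕ) (hx : x ∈ I) => by
    simp only [hI, mem_filter, mem_product, mem_powerset] at hx
    exact exists_signPattern n m x.1 x.2 hx.1.1 hx.2.1 hx.2.2.1 hx.2.2.2
  obtain ⟨δ, hδ, hδf⟩ := exists_pos_le_of_finset I f hf0
  refine ⟨δ, hδ, fun ε hε hε' S hSn hS p hr hp => ?_⟩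
  have hx : (S, p) ∈ I := by
    simp only [hI, mem_filter, mem_product, mem_powerset]
    have := card_le_card hr
    rw [card_range] at this
    exact ⟨⟨hSn, by simp; omega⟩, hS, hr, hp⟩
  exact hf (S, p) hx ε hε (hε'.trans_le (hδf _ hx))

end

/-! ### Signed sets and Gale evenness as a parity condition -/

/-- The signed set with absolute values `i + 1`, `i ∈ T`, and signs `s`. -/
def signedImage (s : ℕ → ℤ) (T : Finset ℕ) : Finset ℤ := T.image fun i => s i * ((i : ℤ) + 1)

section signedImage
variable {s : ℕ → ℤ} {S T : Finset ℕ}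

theorem abs_sign_mul_succ (hs : ∀ i, s i = 1 ∨ s i = -1) (i : ℕ) :
    |s i * ((i : ℤ) + 1)| = (i : ℤ) + 1 := by
  have h1 : |s i| = 1 := by rcases hs i with h | h <;> simp [h]
  rw [abs_mul, h1, one_mul, abs_of_nonneg (by omega)]

theorem signedImage_injective (hs : ∀ i, s i = 1 ∨ s i = -1) :
    Function.Injective fun i : ℕ => s i * ((i : ℤ) + 1) := fun i j h => by
  have := congrArg abs h
  simp only [abs_sign_mul_succ hs] at this
  omega

theorem card_signedImage (hs : ∀ i, s i = 1 ∨ s i = -1) : #(signedImage s T) = #T :=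
  card_image_of_injective _ (signedImage_injective hs)

theorem sign_mul_mem_signedImage (hs : ∀ i, s i = 1 ∨ s i = -1) {i : ℕ} :
    s i * ((i : ℤ) + 1) ∈ signedImage s T ↔ i ∈ T :=
  (signedImage_injective hs).mem_finset_image

theorem mul_succ_mem_signedImage (hs : ∀ i, s i = 1 ∨ s i = -1) {t : ℤ} (ht : t = 1 ∨ t = -1)
    {i : ℕ} : t * ((i : ℤ) + 1) ∈ signedImage s T ↔ i ∈ T ∧ s i = t := by
  constructor
  · intro h
    obtain ⟨j, hj, e⟩ := mem_image.1 h
    have h1 := congrArg abs e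
    rw [abs_sign_mul_succ hs, abs_sign_mul_succ (s := fun _ => t) (fun _ => ht)] at h1
    obtain rfl : j = i := by omega
    exact ⟨hj, mul_right_cancel₀ (by omega) e⟩
  · rintro ⟨h, rfl⟩
    exact (sign_mul_mem_signedImage hs).2 h

theorem natCast_mem_or_neg_mem_signedImage (hs : ∀ i, s i = 1 ∨ s i = -1) {i : ℕ} :
    ((i : ℤ) + 1 ∉ signedImage s T ∧ -((i : ℤ) + 1) ∉ signedImage s T) ↔ i ∉ T := by
  have h1 := mul_succ_mem_signedImage (T := T) (i := i) hs (Or.inl rfl)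
  have h2 := mul_succ_mem_signedImage (T := T) (i := i) hs (Or.inr rfl)
  rw [one_mul] at h1
  rw [neg_one_mul] at h2
  rw [h1, h2]
  have := hs i
  tauto

/-- Gaps and elements strictly between `i` and `j` add up to `j - i - 1`, so evenness of the former
is a parity condition on the latter. -/
theorem galeEven_signedImage (hs : ∀ i, s i = 1 ∨ s i = -1) :
    GaleEven (signedImage s T) ↔
      ∀ i ∈ T, ∀ j ∈ T, i < j → Odd (i + j + #{k ∈ T | i < k ∧ k < j}) := by
  have key : ∀ i j : ℕ, i < j →
      (Even (#{k ∈ Finset.Ioo ((i : ℤ) + 1) ((j : ℤ) + 1) |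
        k ∉ signedImage s T ∧ -k ∉ signedImage s T}) ↔
        Odd (i + j + #{k ∈ T | i < k ∧ k < j})) := by
    intro i j hij
    have h1 : ({k ∈ Finset.Ioo ((i : ℤ) + 1) ((j : ℤ) + 1) |
        k ∉ signedImage s T ∧ -k ∉ signedImage s T}) =
        ({k ∈ Finset.Ioo i j | k ∉ T}).image (fun k : ℕ => (k : ℤ) + 1) := by
      ext k
      simp only [mem_filter, mem_image, mem_Ioo]
      constructor
      · rintro ⟨hk, h⟩
        obtain ⟨l, rfl⟩ : ∃ l : ℕ, k = (l : ℤ) + 1 := ⟨(k - 1).toNat, by omega⟩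
        exact ⟨l, ⟨by omega, (natCast_mem_or_neg_mem_signedImage hs).1 h⟩, rfl⟩
      · rintro ⟨l, ⟨hl, h⟩, rfl⟩
        exact ⟨by omega, (natCast_mem_or_neg_mem_signedImage hs).2 h⟩
    have h2 : #{k ∈ Finset.Ioo i j | k ∉ T} + #{k ∈ T | i < k ∧ k < j} = j - i - 1 := by
      have h3 : {k ∈ T | i < k ∧ k < j} = {k ∈ Finset.Ioo i j | k ∈ T} := by
        ext k; simp only [mem_filter, mem_Ioo]; tauto
      rw [h3, add_comm, card_filter_add_card_filter_not, Nat.card_Ioo]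
    rw [h1, card_image_of_injective _ fun a b h => by simpa using h, Nat.even_iff, Nat.odd_iff]
    omega
  constructor
  · intro h i hi j hj hij
    have := h _ ((sign_mul_mem_signedImage hs).2 hi) _ ((sign_mul_mem_signedImage hs).2 hj)
      (by rw [abs_sign_mul_succ hs, abs_sign_mul_succ hs]; omega)
    rw [abs_sign_mul_succ hs, abs_sign_mul_succ hs] at this
    exact (key i j hij).1 this
  · intro h a ha b hb hab
    obtain ⟨i, hi, rfl⟩ := mem_image.1 ha
    obtain ⟨j, hj, rfl⟩ := mem_image.1 hb
    rw [abs_sign_mul_succ hs, abs_sign_mul_succ hs] at *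
    exact (key i j (by omega)).2 (h i hi j hj (by omega))

end signedImage

/-! ### Equality of signs and the two forms of the criterion -/

/-- The combinatorial form of the condition that all signs in a `SignPattern` are equal. -/
structure SignCondition (S : Finset ℕ) (p : ℕ) (s : ℕ → ℤ) : Prop where
  upper : ∀ i ∈ upperPart S p, ∀ j ∈ upperPart S p, i < j →
    Odd (i + j + #{k ∈ upperPart S p | i < k ∧ k < j})
  last : ∀ b ∈ upperPart S p, (∀ k ∈ upperPart S p, b ≤ k) → ∀ r, p = r + 1 → s r = (-1) ^ b
  initial : ∀ q, q + 1 < p → s q = (-1) ^ (q + 1)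

theorem eq_neg_one_pow_of_pos {t : ℤ} (ht : t = 1 ∨ t = -1) {b : ℕ} {x : ℝ} (hx : 0 < x)
    (h : 0 < (-1 : ℝ) ^ b * ((t : ℝ) * x)) : t = (-1) ^ b := by
  rcases ht with rfl | rfl <;> rcases Nat.even_or_odd b with e | e <;>
    simp only [e.neg_one_pow] at h ⊢ <;> push_cast at h <;> linarith

theorem pos_of_eq_neg_one_pow {b : ℕ} {x : ℝ} {t : ℤ} (ht : t = (-1) ^ b)
    (h : 0 < (-1 : ℝ) ^ b * ((t : ℝ) * x)) : 0 < x := by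
  subst ht
  rcases Nat.even_or_odd b with e | e <;>
    simp only [e.neg_one_pow] at h <;> push_cast at h <;> linarith

theorem SignPattern.signCondition {S : Finset ℕ} {p : ℕ} {s : ℕ → ℤ} {v : ℕ → ℝ}
    (hs : ∀ i, s i = 1 ∨ s i = -1) (hr : range p ⊆ S)
    (h : SignPattern S p (fun i => (s i : ℝ)) v) (hv : ∀ i ∈ S, 0 < v i) :
    SignCondition S p s := by
  have hu : ∀ i ∈ upperPart S p, 0 < v i := fun i hi => hv i (mem_upperPart.1 hi).1
  refine ⟨fun i hi j hj hij => ?_, fun b hb hmin r hpr => ?_, fun q hq => ?_⟩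
  · have h1 := h.upper i hi j hj hij
    have h2 := mul_pos (hu i hi) (hu j hj)
    by_contra hodd
    rw [Nat.not_odd_iff_even] at hodd
    rw [hodd.neg_one_pow] at h1
    linarith
  · exact eq_neg_one_pow_of_pos (hs r) (mul_pos (hv r (hr (by simp; omega))) (hu b hb))
      (h.last b hb hmin r hpr)
  · exact eq_neg_one_pow_of_pos (hs q)
      (mul_pos (hv q (hr (by simp; omega))) (hv (q + 1) (hr (by simp; omega)))) (h.initial q hq)

theorem mul_pos_trans {x y z : ℝ} (h1 : 0 < x * y) (h2 : 0 < y * z) : 0 < x * z := by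
  have hy : 0 < y * y := by
    have : y ≠ 0 := right_ne_zero_of_mul h1.ne'
    exact mul_self_pos.2 this
  have : 0 < (y * y) * (x * z) := by nlinarith [mul_pos h1 h2]
  exact pos_of_mul_pos_right this hy.le

/-- The sign relations link the initial segment in a chain, its end to the least upper index, and
that index to all others; so a single reference entry `e` suffices. -/
theorem SignPattern.exists_forall_mul_pos {S : Finset ℕ} {p : ℕ} {s : ℕ → ℤ} {v : ℕ → ℝ}
    (hS : S.Nonempty) (hr : range p ⊆ S) (hp : p ∉ S)
    (h : SignPattern S p (fun i => (s i : ℝ)) v) (hc : SignCondition S p s) :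
    ∃ e ∈ S, ∀ i ∈ S, 0 < v i * v e := by
  have hmemS : ∀ i ∈ S, i < p ∨ i ∈ upperPart S p := fun i hi => by
    rcases lt_trichotomy i p with h | rfl | h
    · exact Or.inl h
    · exact absurd hi hp
    · exact Or.inr (mem_upperPart.2 ⟨hi, h⟩)
  have hself : ∀ i ∈ S, 0 < v i * v i := fun i hi => mul_self_pos.2 (h.ne_zero i hi)
  have hinit : ∀ e, (∀ r, p = r + 1 → 0 < v r * v e) → ∀ q < p, 0 < v q * v e := by
    intro e he
    have : ∀ t q, q + t + 1 = p → 0 < v q * v e := by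
      intro t
      induction t with
      | zero => exact fun q hq => he q hq.symm
      | succ t ih =>
        intro q hq
        exact mul_pos_trans (pos_of_eq_neg_one_pow (hc.initial q (by omega))
          (h.initial q (by omega))) (ih (q + 1) (by omega))
    exact fun q hq => this (p - q - 1) q (by omega)
  rcases (upperPart S p).eq_empty_or_nonempty with he | hne
  · obtain ⟨a, ha⟩ := hS
    have hlt : ∀ i ∈ S, i < p := fun i hi => by
      rcases hmemS i hi with h | h
      · exact h
      · rw [he] at h; simp at h
    refine ⟨p - 1, hr (by have := hlt a ha; simp; omega), fun i hi => hinit _ (fun r hpr => ?_) i (hlt i hi)⟩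
    subst hpr
    exact hself _ (hr (by simp))
  · set b := (upperPart S p).min' hne with hb
    have hbm : b ∈ upperPart S p := min'_mem _ _
    have hbmin : ∀ k ∈ upperPart S p, b ≤ k := fun k hk => min'_le _ _ hk
    refine ⟨b, (mem_upperPart.1 hbm).1, fun i hi => ?_⟩
    rcases hmemS i hi with hip | hiu
    · refine hinit b (fun r hpr => ?_) i hip
      exact pos_of_eq_neg_one_pow (hc.last b hbm hbmin r hpr) (h.last b hbm hbmin r hpr)
    · rcases (hbmin i hiu).eq_or_lt with rfl | hlt
      · exact hself _ hi
      · have h1 := h.upper b hbm i hiu hlt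
        rw [(hc.upper b hbm i hiu hlt).neg_one_pow] at h1
        linarith

theorem neg_one_pow_eq_iff {a b : ℕ} : ((-1 : ℤ) ^ a = (-1) ^ b) ↔ (a % 2 = b % 2) := by
  rcases Nat.even_or_odd a with ha | ha <;> rcases Nat.even_or_odd b with hb | hb <;>
    rw [ha.neg_one_pow, hb.neg_one_pow] <;>
    simp only [Nat.even_iff, Nat.odd_iff] at ha hb <;> omega

/-- The bound `min β > p + 1` leaves the absolute value `p + 1`, which is the index `p`, out of the
set. Hence `p` is the first gap and `β` is the part above it. -/
theorem FormPos.firstMissing {n d p : ℕ} {s : ℕ → ℤ} {S : Finset ℕ}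
    (hs : ∀ i, s i = 1 ∨ s i = -1) (hp : 1 ≤ p) (h : FormPos n d p (signedImage s S)) :
    range p ⊆ S ∧ p ∉ S ∧ SignCondition S p s := by
  obtain ⟨t, β, ht, hα, -, hβ⟩ := h
  have hmin : ∀ a ∈ β, ∃ m : ℤ, IsLeast ((fun b : ℤ => |b|) '' (β : Set ℤ)) m ∧ m ≤ |a| := by
    intro a ha
    obtain ⟨c, hc, hcm⟩ := exists_min_image β (fun b => |b|) ⟨a, ha⟩
    refine ⟨|c|, ⟨⟨c, hc, rfl⟩, ?_⟩, hcm a ha⟩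
    rintro _ ⟨b, hb, rfl⟩
    exact hcm b hb
  have hbig : ∀ a ∈ β, (p : ℤ) + 1 < |a| := fun a ha => by
    obtain ⟨m, hm, hma⟩ := hmin a ha
    exact (hβ m hm).1.trans_le hma
  have hpre : ∀ a ∈ signPrefix p t, |a| ≤ p := by
    intro a ha
    simp only [signPrefix, mem_insert, mem_image, mem_Icc] at ha
    rcases ha with rfl | ⟨i, hi, rfl⟩
    · rcases ht with rfl | rfl <;> simp
    · rw [abs_mul, abs_pow]
      simp
      omega
  have hinit : ∀ q, q + 1 < p → q ∈ S ∧ s q = (-1) ^ (q + 1) := by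
    intro q hq
    have h1 : (-1 : ℤ) ^ (q + 1) * ((q : ℤ) + 1) ∈ signedImage s S := by
      rw [hα]
      refine mem_union_left _ (mem_insert_of_mem (mem_image.2 ⟨q + 1, by simp; omega, ?_⟩))
      push_cast
      ring
    exact (mul_succ_mem_signedImage hs (neg_one_pow_eq_or ℤ _)).1 h1
  have hlast : ∀ r, p = r + 1 → r ∈ S ∧ s r = t := by
    rintro r rfl
    have h1 : t * ((r : ℤ) + 1) ∈ signedImage s S := by
      rw [hα]
      refine mem_union_left _ (mem_insert.2 (Or.inl ?_))
      push_cast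
      ring
    exact (mul_succ_mem_signedImage hs ht).1 h1
  have hrange : range p ⊆ S := by
    intro q hq
    rw [mem_range] at hq
    by_cases h : q + 1 < p
    · exact (hinit q h).1
    · exact (hlast q (by omega)).1
  have hpS : p ∉ S := by
    intro hpS
    have h1 := (sign_mul_mem_signedImage hs).2 hpS
    have h2 := abs_sign_mul_succ hs p
    rw [hα, mem_union] at h1
    rcases h1 with h1 | h1
    · have := hpre _ h1; omega
    · have := hbig _ h1; omega
  have hβeq : β = signedImage s (upperPart S p) := by
    ext a
    constructor
    · intro ha
      have h1 : a ∈ signedImage s S := hα ▸ mem_union_right _ ha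
      obtain ⟨i, hi, rfl⟩ := mem_image.1 h1
      have h2 := hbig _ ha
      rw [abs_sign_mul_succ hs] at h2
      exact (sign_mul_mem_signedImage hs).2 (mem_upperPart.2 ⟨hi, by omega⟩)
    · intro ha
      obtain ⟨i, hi, rfl⟩ := mem_image.1 ha
      rw [mem_upperPart] at hi
      have h1 := (sign_mul_mem_signedImage hs).2 hi.1
      rw [hα, mem_union] at h1
      rcases h1 with h1 | h1
      · have := hpre _ h1
        rw [abs_sign_mul_succ hs] at this
        omega
      · exact h1
  refine ⟨hrange, hpS, ⟨fun i hi => ?_, fun b hb hbmin r hpr => ?_, fun q hq => (hinit q hq).2⟩⟩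
  · obtain ⟨m, hm, -⟩ := hmin _ (hβeq ▸ (sign_mul_mem_signedImage hs).2 hi)
    have := (hβ m hm).2.1
    rw [hβeq, galeEven_signedImage hs] at this
    exact this i hi
  · have hm : IsLeast ((fun b : ℤ => |b|) '' (β : Set ℤ)) ((b : ℤ) + 1) := by
      constructor
      · exact ⟨_, hβeq ▸ (sign_mul_mem_signedImage hs).2 hb, abs_sign_mul_succ hs b⟩
      · rintro _ ⟨a, ha, rfl⟩
        rw [hβeq] at ha
        obtain ⟨i, hi, rfl⟩ := mem_image.1 ha
        have := hbmin i hi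
        simp only [abs_sign_mul_succ hs]
        omega
    obtain ⟨-, -, h1, h2⟩ := hβ _ hm
    rw [(hlast r hpr).2]
    -- As `min β = b + 1`, both parity clauses say the same thing: `t = (-1) ^ b`.
    have ht' : t = (-1) ^ (p + 1) ∨ t = (-1) ^ p := by
      rw [pow_succ]
      rcases ht with rfl | rfl <;> rcases Nat.even_or_odd p with e | e <;> simp [e.neg_one_pow]
    rcases ht' with e | e
    · have := h1 e
      rw [e, neg_one_pow_eq_iff]
      rw [Int.even_iff] at this
      omega
    · have := h2 e
      rw [e, neg_one_pow_eq_iff]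
      rw [Int.odd_iff] at this
      omega

theorem SignCondition.formPos {n d p : ℕ} {s : ℕ → ℤ} {S : Finset ℕ}
    (hs : ∀ i, s i = 1 ∨ s i = -1) (hp : 1 ≤ p) (hS : #S = n - d + 1) (hr : range p ⊆ S)
    (hpS : p ∉ S) (h : SignCondition S p s) : FormPos n d p (signedImage s S) := by
  have hcard := card_upperPart hr hpS
  refine ⟨s (p - 1), signedImage s (upperPart S p), hs _, ?_, ?_, fun m hm => ?_⟩
  · ext a
    simp only [signPrefix, mem_union, mem_insert, mem_image, mem_Icc]
    constructor
    · intro ha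
      obtain ⟨i, hi, rfl⟩ := mem_image.1 ha
      rcases lt_trichotomy i p with hip | rfl | hip
      · left
        rcases eq_or_ne (i + 1) p with rfl | hne
        · left; simp
        · right
          refine ⟨i + 1, by omega, ?_⟩
          rw [h.initial i (by omega)]
          push_cast
          ring
      · exact absurd hi hpS
      · exact Or.inr ((sign_mul_mem_signedImage hs).2 (mem_upperPart.2 ⟨hi, hip⟩))
    · rintro ((rfl | ⟨i, hi, rfl⟩) | ha)
      · obtain ⟨r, rfl⟩ : ∃ r, p = r + 1 := ⟨p - 1, by omega⟩
        have := (sign_mul_mem_signedImage (T := S) (i := r) hs).2 (hr (by simp))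
        simpa using this
      · obtain ⟨r, rfl⟩ : ∃ r, i = r + 1 := ⟨i - 1, by omega⟩
        have := (sign_mul_mem_signedImage (T := S) (i := r) hs).2 (hr (by simp; omega))
        rw [h.initial r (by omega)] at this
        simpa using this
      · obtain ⟨i, hi, rfl⟩ := mem_image.1 ha
        exact (sign_mul_mem_signedImage hs).2 (mem_upperPart.1 hi).1
  · rw [card_signedImage hs]; omega
  · obtain ⟨a, ha, rfl⟩ := hm.1
    obtain ⟨b, hb, rfl⟩ := mem_image.1 ha
    have hbmin : ∀ k ∈ upperPart S p, b ≤ k := fun k hk => by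
      have := hm.2 ⟨_, (sign_mul_mem_signedImage hs).2 hk, rfl⟩
      simp only [abs_sign_mul_succ hs] at this
      omega
    have hl := h.last b hb hbmin (p - 1) (by omega)
    have := (mem_upperPart.1 hb).2
    simp only [abs_sign_mul_succ hs]
    refine ⟨by omega, (galeEven_signedImage hs).2 h.upper, fun e => ?_, fun e => ?_⟩
    · rw [hl, neg_one_pow_eq_iff] at e
      rw [Int.even_iff]; omega
    · rw [hl, neg_one_pow_eq_iff] at e
      rw [Int.odd_iff]; omega

theorem cubicalGaleEven_iff_signCondition {n d p : ℕ} {s : ℕ → ℤ} {S : Finset ℕ}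
    (hs : ∀ i, s i = 1 ∨ s i = -1) (hS : #S = n - d + 1) (hr : range p ⊆ S) (hpS : p ∉ S) :
    CubicalGaleEven n d (signedImage s S) ↔ SignCondition S p s := by
  have h0 : ((1 : ℤ) ∉ signedImage s S ∧ (-1 : ℤ) ∉ signedImage s S) ↔ 0 ∉ S := by
    have := natCast_mem_or_neg_mem_signedImage (T := S) (i := 0) hs
    simpa using this
  have hu : 0 ∉ S → upperPart S 0 = S := fun h => by
    ext i
    rw [mem_upperPart]
    exact ⟨fun h => h.1, fun hi => ⟨hi, Nat.pos_of_ne_zero fun e => h (e ▸ hi)⟩⟩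
  have huniq : ∀ q, range q ⊆ S → q ∉ S → q = p := fun q hq hqS => by
    rcases lt_trichotomy q p with h | h | h
    · exact absurd (hr (mem_range.2 h)) hqS
    · exact h
    · exact absurd (hq (mem_range.2 h)) hpS
  constructor
  · rintro (⟨h1, h2, h3⟩ | ⟨q, hq, -, h⟩)
    · have hz := h0.1 ⟨h1, h2⟩
      obtain rfl := huniq 0 (by simp) hz
      refine ⟨?_, fun _ _ _ r h => by omega, fun q h => by omega⟩
      rw [hu hz]
      exact (galeEven_signedImage hs).1 h3
    · obtain ⟨h1, h2, h3⟩ := h.firstMissing hs hq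
      exact huniq q h1 h2 ▸ h3
  · intro h
    rcases Nat.eq_zero_or_pos p with rfl | hp
    · refine Or.inl ⟨(h0.2 hpS).1, (h0.2 hpS).2, (galeEven_signedImage hs).2 ?_⟩
      have := h.upper
      rwa [hu hpS] at this
    · refine Or.inr ⟨p, hp, ?_, h.formPos hs hp hS hr hpS⟩
      have := card_upperPart hr hpS
      omega

/-! ### Geometry of the deformed cube and its faces -/

section
variable {n : ℕ} {ε : ℝ}

/-- `lowerPart` as a linear functional. -/
noncomputable def lowerPartₗ (i : Fin n) : (Fin n → ℝ) →ₗ[ℝ] ℝ :=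
  ∑ j : Fin n, lowerCoeff i j • LinearMap.proj j

theorem lowerPartₗ_eq_sum (i : Fin n) (x : Fin n → ℝ) :
    lowerPartₗ i x = ∑ j : Fin n, lowerCoeff i j * x j := by
  simp [lowerPartₗ]

theorem lowerPart_eq (x : Fin n → ℝ) (i : Fin n) : lowerPart x i = lowerPartₗ i x := by
  rw [lowerPartₗ_eq_sum, lowerPart, mul_sum]
  have : Finset.Iio i = Finset.univ.filter (· < i) := by ext; simp
  rw [this, sum_filter]
  refine sum_congr rfl fun j _ => ?_
  simp only [lowerCoeff, Fin.lt_def]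
  split_ifs <;> ring

theorem bound_pos (hε : 0 < ε) (i : ℕ) : 0 < bound ε i := by
  unfold bound; positivity

/-- Opposite inequalities are never tight together. Inductively `|x j| < 2 * bound ε j / ε`, the
binomials for `i ≥ 1` sum to `2 ^ (i - 1)`, and `binom (i+1) 2 = binom i 2 + i` closes the estimate.
Assuming only the inequalities below `i` lets points be built coordinate by coordinate. -/
theorem abs_lowerPart_lt_bound (hε : 0 < ε) (hε1 : ε ≤ 1) {x : Fin n → ℝ} (i : Fin n)
    (h : ∀ j < i, ε * |x j| ≤ bound ε j - lowerPart x j) : |lowerPart x i| < bound ε i := by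
  induction i using WellFoundedLT.induction with
  | ind i ih =>
  have hx : ∀ j < i, |x j| < 2 ^ ((i : ℕ).choose 2 + 1) / ε ^ (i : ℕ) := by
    intro j hj
    have h1 := ih j hj fun k hk => h k (hk.trans hj)
    have h2 := h j hj
    have h3 : ε * |x j| < 2 * bound ε j := by have := (abs_lt.1 h1).1; linarith
    have hji : (j : ℕ) + 1 ≤ i := hj
    have h4 : |x j| < 2 ^ (((j : ℕ) + 1).choose 2 + 1) / ε ^ ((j : ℕ) + 1) := by
      rw [lt_div_iff₀ (by positivity)]
      rw [bound, ← mul_div_assoc, lt_div_iff₀ (by positivity)] at h3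
      rw [pow_succ, pow_succ]
      linarith
    refine h4.trans_le ?_
    refine div_le_div₀ (by positivity) ?_ (by positivity) ?_
    · exact pow_le_pow_right₀ one_le_two (by have := Nat.choose_le_choose 2 hji; omega)
    · exact pow_le_pow_of_le_one hε.le hε1 hji
  rw [lowerPart, abs_mul, abs_pow, abs_neg, abs_one, one_pow, one_mul]
  obtain ⟨i, hi⟩ := i
  rcases i with _ | i
  · have : Finset.Iio (⟨0, hi⟩ : Fin n) = ∅ := by ext j; simp [Fin.lt_def]
    rw [this]
    simpa using bound_pos hε 0
  · refine (abs_sum_le_sum_abs _ _).trans_lt ?_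
    have e : ∑ j ∈ Finset.Iio (⟨i + 1, hi⟩ : Fin n), ((i.choose (j : ℕ) : ℕ) : ℝ) = 2 ^ i := by
      have h1 : ∑ j ∈ range (i + 1), ((i.choose j : ℕ) : ℝ) = 2 ^ i := by
        exact_mod_cast Nat.sum_range_choose i
      rw [← h1]
      refine sum_bij (fun j _ => (j : ℕ)) ?_ ?_ ?_ ?_
      · intro j hj; simpa [Fin.lt_def] using hj
      · intro a _ b _ hab; exact Fin.ext hab
      · intro b hb
        exact ⟨⟨b, by simp at hb; omega⟩, by simpa [Fin.lt_def] using hb, rfl⟩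
      · intros; rfl
    have hb : bound ε (i + 1) = 2 ^ i * (2 ^ ((i + 1).choose 2 + 1) / ε ^ (i + 1)) := by
      rw [bound, ← mul_div_assoc, ← pow_add]
      congr 2
      rw [Nat.choose_succ_succ' (i + 1) 1]
      simp
      omega
    simp only [Nat.add_sub_cancel]
    rw [hb, ← e, sum_mul]
    refine sum_lt_sum_of_nonempty ⟨⟨0, by omega⟩, by simp [Fin.lt_def]⟩ fun j hj => ?_
    rw [mem_Iio] at hj
    rw [abs_mul, Nat.abs_cast]
    refine mul_lt_mul_of_pos_left (hx j hj) ?_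
    have : 0 < i.choose j := Nat.choose_pos (by have : (j : ℕ) < i + 1 := hj; omega)
    exact_mod_cast this

theorem lowerPart_lt_bound (hε : 0 < ε) (hε1 : ε ≤ 1) {x : Fin n → ℝ} (hx : x ∈ deformedCube n ε)
    (i : Fin n) : lowerPart x i < bound ε i :=
  (abs_lt.1 (abs_lowerPart_lt_bound hε hε1 i fun j _ => hx j)).2

/-- Triangular systems whose lower parts are multiples of `lowerPart` can be solved. -/
theorem exists_triangular_solution (hε : 0 < ε) (t b : Fin n → ℝ) :
    ∃ x : Fin n → ℝ, ∀ i, ε * x i + t i * lowerPart x i = b i := by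
  set T : (Fin n → ℝ) →ₗ[ℝ] (Fin n → ℝ) :=
    LinearMap.pi fun i => ε • LinearMap.proj i + t i • lowerPartₗ i with hT
  have hTa : ∀ x i, T x i = ε * x i + t i * lowerPart x i := fun x i => by
    simp [hT, lowerPart_eq]
  have hinj : Function.Injective T := by
    rw [← LinearMap.ker_eq_bot, LinearMap.ker_eq_bot']
    intro x hx
    funext i
    induction i using WellFoundedLT.induction with
    | ind i ih =>
    have h1 : lowerPart x i = 0 := by
      rw [lowerPart, sum_eq_zero, mul_zero]
      intro j hj
      rw [ih j (mem_Iio.1 hj)]; simp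
    have h2 := hTa x i
    rw [h1, hx] at h2
    simpa [hε.ne'] using h2.symm
  obtain ⟨x, hx⟩ := LinearMap.injective_iff_surjective.1 hinj b
  exact ⟨x, fun i => by rw [← hTa, hx]⟩

/-- Parametrizes the deformed cube by a standard one: `t i` is the relative position of `x i` in the
interval that the earlier coordinates allow. -/
theorem exists_mem_deformedCube (hε : 0 < ε) (hε1 : ε ≤ 1) (t : Fin n → ℝ) (ht : ∀ i, |t i| ≤ 1) :
    ∃ x ∈ deformedCube n ε, ∀ i, ε * x i = t i * (bound ε i - lowerPart x i) := by
  obtain ⟨x, hx⟩ := exists_triangular_solution hε t fun i => t i * bound ε i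
  have hx' : ∀ i, ε * x i = t i * (bound ε i - lowerPart x i) := fun i => by
    linear_combination hx i
  refine ⟨x, fun i => ?_, hx'⟩
  induction i using WellFoundedLT.induction with
  | ind i ih =>
  have h1 := (abs_lt.1 (abs_lowerPart_lt_bound hε hε1 i ih)).2
  rw [← abs_of_pos hε, ← abs_mul, abs_of_pos hε, hx', abs_mul, abs_of_pos (sub_pos.2 h1)]
  exact mul_le_of_le_one_left (sub_pos.2 h1).le (ht i)

section Face
variable {s : ℕ → ℤ} {S : Finset ℕ}

theorem mem_cubeFace_signedImage (hs : ∀ i, s i = 1 ∨ s i = -1) {x : Fin n → ℝ} :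
    x ∈ cubeFace n ε (signedImage s S) ↔ x ∈ deformedCube n ε ∧
      ∀ i : Fin n, (i : ℕ) ∈ S → lowerPart x i + (s i : ℝ) * ε * x i = bound ε i := by
  refine and_congr_right fun _ => ⟨fun h i hi => ?_, fun h i σ hσ hm => ?_⟩
  · exact h i _ (hs i) ((sign_mul_mem_signedImage hs).2 hi)
  · obtain ⟨h1, rfl⟩ := (mul_succ_mem_signedImage hs hσ).1 hm
    exact h i h1

theorem sign_mul_self (hs : ∀ i, s i = 1 ∨ s i = -1) (i : ℕ) : (s i : ℝ) * s i = 1 := by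
  rcases hs i with h | h <;> simp [h]

theorem abs_sign (hs : ∀ i, s i = 1 ∨ s i = -1) (i : ℕ) : |(s i : ℝ)| = 1 := by
  rcases hs i with h | h <;> simp [h]

/-- The centre of a face of the deformed cube. -/
theorem exists_face_center (hε : 0 < ε) (hε1 : ε ≤ 1) (hs : ∀ i, s i = 1 ∨ s i = -1) (S : Finset ℕ) :
    ∃ x ∈ cubeFace n ε (signedImage s S), ∀ i : Fin n,
      ((i : ℕ) ∈ S → 0 < (s i : ℝ) * x i) ∧ ((i : ℕ) ∉ S → x i = 0) := by
  classical
  obtain ⟨x, hx, hx'⟩ := exists_mem_deformedCube (n := n) hε hε1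
    (fun i => if (i : ℕ) ∈ S then (s i : ℝ) else 0) fun i => by
      split_ifs
      · exact (abs_sign hs i).le
      · simp
  have hlt := lowerPart_lt_bound hε hε1 hx
  refine ⟨x, (mem_cubeFace_signedImage hs).2 ⟨hx, fun i hi => ?_⟩, fun i => ⟨fun hi => ?_, fun hi => ?_⟩⟩
  · have := hx' i
    rw [if_pos hi] at this
    linear_combination (s i : ℝ) * this + (bound ε i - lowerPart x i) * sign_mul_self hs i
  · have := hx' i
    rw [if_pos hi] at this
    have h1 : ε * ((s i : ℝ) * x i) = bound ε i - lowerPart x i := by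
      linear_combination (s i : ℝ) * this + (bound ε i - lowerPart x i) * sign_mul_self hs i
    have h2 : 0 < ε * ((s i : ℝ) * x i) := h1 ▸ sub_pos.2 (hlt i)
    exact pos_of_mul_pos_right h2 hε.le
  · have := hx' i
    rw [if_neg hi, zero_mul] at this
    simpa [hε.ne'] using this

/-- The centre of a face remembers the face: a tight row forces a nonzero coordinate of its sign,
and the centre has such coordinates only at the indices and signs of its own face. -/
theorem signedImage_subset_of_cubeFace_subset (hε : 0 < ε) (hε1 : ε ≤ 1)
    (hs : ∀ i, s i = 1 ∨ s i = -1) {s' : ℕ → ℤ} {S' : Finset ℕ} (hs' : ∀ i, s' i = 1 ∨ s' i = -1)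
    (hS' : S' ⊆ range n)
    (h : cubeFace n ε (signedImage s S) ⊆ cubeFace n ε (signedImage s' S')) :
    signedImage s' S' ⊆ signedImage s S := by
  intro a ha
  obtain ⟨i, hi, rfl⟩ := mem_image.1 ha
  obtain ⟨x, hx, hx'⟩ := exists_face_center (n := n) hε hε1 hs S
  set j : Fin n := ⟨i, mem_range.1 (hS' hi)⟩
  obtain ⟨hC, h1⟩ := (mem_cubeFace_signedImage hs').1 (h hx)
  have h2 := h1 j hi
  have h3 := lowerPart_lt_bound hε hε1 hC j
  have h4 : 0 < (s' i : ℝ) * x j := by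
    have : 0 < ε * ((s' i : ℝ) * x j) := by
      have e : ((s' (j : ℕ) : ℤ) : ℝ) = s' i := rfl
      rw [e] at h2
      linarith
    exact pos_of_mul_pos_right this hε.le
  have hiS : i ∈ S := by
    by_contra hcon
    rw [(hx' j).2 hcon, mul_zero] at h4
    exact lt_irrefl _ h4
  have h5 := (hx' j).1 hiS
  refine (mul_succ_mem_signedImage hs (hs' i)).2 ⟨hiS, ?_⟩
  have e : ((s (j : ℕ) : ℤ) : ℝ) = s i := rfl
  rw [e] at h5
  rcases hs i with a | a <;> rcases hs' i with b | b <;> rw [a, b] <;> rw [a] at h5 <;>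
    rw [b] at h4 <;> push_cast at h4 h5 <;> linarith

/-- The left-hand sides of the equations of a face. -/
noncomputable def faceMap (n : ℕ) (ε : ℝ) (s : ℕ → ℤ) (S : Finset ℕ) :
    (Fin n → ℝ) →ₗ[ℝ] ({i : Fin n // (i : ℕ) ∈ S} → ℝ) :=
  LinearMap.pi fun i => lowerPartₗ i.1 + ((s i.1 : ℝ) * ε) • LinearMap.proj i.1

theorem faceMap_apply (x : Fin n → ℝ) (i : {i : Fin n // (i : ℕ) ∈ S}) :
    faceMap n ε s S x i = lowerPart x i.1 + (s i.1 : ℝ) * ε * x i.1 := by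
  simp [faceMap, lowerPart_eq]

theorem faceMap_surjective (hε : 0 < ε) (hs : ∀ i, s i = 1 ∨ s i = -1) :
    Function.Surjective (faceMap n ε s S) := by
  classical
  intro b
  obtain ⟨x, hx⟩ := exists_triangular_solution (n := n) hε (fun i => (s i : ℝ))
    fun i => if h : (i : ℕ) ∈ S then (s i : ℝ) * b ⟨i, h⟩ else 0
  refine ⟨x, funext fun i => ?_⟩
  have h1 := hx i.1
  rw [dif_pos i.2] at h1
  rw [faceMap_apply]
  linear_combination (s i.1 : ℝ) * h1 + (b i - lowerPart x i.1) * sign_mul_self hs i.1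

/-- At the centre every inequality outside the face is strict, so a small step along any kernel
vector stays in the face. -/
theorem vectorSpan_cubeFace (hε : 0 < ε) (hε1 : ε ≤ 1) (hs : ∀ i, s i = 1 ∨ s i = -1) :
    vectorSpan ℝ (cubeFace n ε (signedImage s S)) = LinearMap.ker (faceMap n ε s S) := by
  apply le_antisymm
  · rw [vectorSpan_def, Submodule.span_le]
    rintro _ ⟨x, hx, y, hy, rfl⟩
    rw [mem_cubeFace_signedImage hs] at hx hy
    simp only [SetLike.mem_coe, LinearMap.mem_ker, vsub_eq_sub, map_sub, sub_eq_zero]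
    funext i
    rw [faceMap_apply, faceMap_apply, hx.2 i.1 i.2, hy.2 i.1 i.2]
  · intro v hv
    obtain ⟨x, hx, hx'⟩ := exists_face_center (n := n) hε hε1 hs S
    have hxm := (mem_cubeFace_signedImage hs).1 hx
    have hlt := lowerPart_lt_bound hε hε1 hxm.1
    have hL : ∀ i (δ : ℝ), lowerPart (x + δ • v) i = lowerPart x i + δ * lowerPart v i :=
      fun i δ => by simp [lowerPart_eq]
    have hev : ∀ᶠ δ : ℝ in 𝓝[>] 0, ∀ i : Fin n,
        ((i : ℕ) ∈ S → 0 < (s i : ℝ) * (x i + δ * v i)) ∧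
        ((i : ℕ) ∉ S → ε * |x i + δ * v i| < bound ε i - (lowerPart x i + δ * lowerPart v i)) := by
      refine eventually_all.2 fun i => Filter.Eventually.filter_mono nhdsWithin_le_nhds ?_
      by_cases hi : (i : ℕ) ∈ S
      · have h1 : ∀ᶠ δ : ℝ in 𝓝 0, 0 < (s i : ℝ) * (x i + δ * v i) := by
          have hc : Continuous fun δ : ℝ => (s i : ℝ) * (x i + δ * v i) := by fun_prop
          refine hc.continuousAt.eventually (lt_mem_nhds ?_)
          simpa using (hx' i).1 hi
        filter_upwards [h1] with δ h
        exact ⟨fun _ => h, fun h' => absurd hi h'⟩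
      · have h1 : ∀ᶠ δ : ℝ in 𝓝 0,
            0 < bound ε i - (lowerPart x i + δ * lowerPart v i) - ε * |x i + δ * v i| := by
          have hc : Continuous fun δ : ℝ =>
            bound ε i - (lowerPart x i + δ * lowerPart v i) - ε * |x i + δ * v i| := by fun_prop
          refine hc.continuousAt.eventually (lt_mem_nhds ?_)
          simp [(hx' i).2 hi, hlt i]
        filter_upwards [h1] with δ h
        exact ⟨fun h' => absurd h' hi, fun _ => by linarith⟩
    obtain ⟨δ, hδ, hδ0⟩ := (hev.and self_mem_nhdsWithin).exists
    have hδ0 : 0 < δ := hδ0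
    have hmem : x + δ • v ∈ cubeFace n ε (signedImage s S) := by
      have heq : ∀ i : Fin n, (i : ℕ) ∈ S →
          lowerPart (x + δ • v) i + (s i : ℝ) * ε * (x + δ • v) i = bound ε i := by
        intro i hi
        have h1 := congrFun (LinearMap.mem_ker.1 hv) ⟨i, hi⟩
        rw [faceMap_apply] at h1
        simp only [Pi.zero_apply] at h1
        rw [hL]
        simp only [Pi.add_apply, Pi.smul_apply, smul_eq_mul]
        linear_combination hxm.2 i hi + δ * h1
      refine (mem_cubeFace_signedImage hs).2 ⟨fun i => ?_, heq⟩
      by_cases hi : (i : ℕ) ∈ S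
      · have h1 := (hδ i).1 hi
        have h2 := heq i hi
        have h3 : |(x + δ • v) i| = (s i : ℝ) * (x + δ • v) i := by
          have h4 : |(s i : ℝ) * (x + δ • v) i| = |(x + δ • v) i| := by
            rw [abs_mul, abs_sign hs, one_mul]
          rw [← h4]
          exact abs_of_pos (by simpa using h1)
        rw [h3]
        linarith
      · rw [hL]
        simpa using ((hδ i).2 hi).le
    have h1 : δ • v ∈ vectorSpan ℝ (cubeFace n ε (signedImage s S)) := by
      have := vsub_mem_vectorSpan ℝ hmem hx
      simpa using this
    have h2 := Submodule.smul_mem _ δ⁻¹ h1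
    rwa [smul_smul, inv_mul_cancel₀ hδ0.ne', one_smul] at h2

end Face

end

/-! ### Dimensions of projected faces by linear duality -/

section
theorem finrank_map_ker_add_finrank_inf {V X Y : Type*} [AddCommGroup V] [Module ℝ V]
    [FiniteDimensional ℝ V] [AddCommGroup X] [Module ℝ X] [AddCommGroup Y] [Module ℝ Y]
    (f : V →ₗ[ℝ] X) (g : V →ₗ[ℝ] Y) :
    Module.finrank ℝ (Submodule.map f (LinearMap.ker g)) +
      Module.finrank ℝ (LinearMap.ker g ⊓ LinearMap.ker f : Submodule ℝ V) =
      Module.finrank ℝ (LinearMap.ker g) := by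
  have h := LinearMap.finrank_range_add_finrank_ker (f.domRestrict (LinearMap.ker g))
  rw [LinearMap.range_domRestrict, LinearMap.ker_domRestrict] at h
  rw [← h, (Submodule.equivSubtypeMap (LinearMap.ker g)
    (Submodule.comap (LinearMap.ker g).subtype (LinearMap.ker f))).finrank_eq,
    Submodule.map_comap_subtype]

/-- The dimension of the image of a kernel, counted by the dependencies among the equations. -/
theorem finrank_map_ker_add_finrank_dualAnnihilator {V W U : Type*} [AddCommGroup V] [Module ℝ V]
    [FiniteDimensional ℝ V] [AddCommGroup W] [Module ℝ W] [FiniteDimensional ℝ W] [AddCommGroup U]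
    [Module ℝ U] [FiniteDimensional ℝ U] (π : V →ₗ[ℝ] W) (A : V →ₗ[ℝ] U)
    (hπ : Function.Surjective π) (hA : Function.Surjective A) :
    Module.finrank ℝ (Submodule.map π (LinearMap.ker A)) +
      Module.finrank ℝ (Submodule.map A (LinearMap.ker π)).dualAnnihilator =
      Module.finrank ℝ W := by
  -- Both restrictions, `π` on `ker A` and `A` on `ker π`, have kernel `ker A ⊓ ker π`, whose
  -- dimension is eliminated.
  have h1 := finrank_map_ker_add_finrank_inf π A
  have h2 := finrank_map_ker_add_finrank_inf A π
  rw [inf_comm] at h2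
  have h3 := Subspace.finrank_add_finrank_dualAnnihilator_eq (Submodule.map A (LinearMap.ker π))
  have h4 := LinearMap.finrank_range_add_finrank_ker π
  have h5 := LinearMap.finrank_range_add_finrank_ker A
  rw [LinearMap.range_eq_top.2 hπ, finrank_top] at h4
  rw [LinearMap.range_eq_top.2 hA, finrank_top] at h5
  omega

theorem exists_mem_ne_zero_of_finrank_pos {V : Type*} [AddCommGroup V] [Module ℝ V]
    {N : Submodule ℝ V} (h : 0 < Module.finrank ℝ N) : ∃ x ∈ N, x ≠ 0 := by
  refine Submodule.exists_mem_ne_zero_of_ne_bot ?_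
  rintro rfl
  simp at h

variable {n d : ℕ} {ε : ℝ} {s : ℕ → ℤ} {S : Finset ℕ}

theorem projLast_surjective (h : d ≤ n) : Function.Surjective (projLast h) :=
  LinearMap.funLeft_surjective_of_injective _ _ _ fun i j hij => by
    simp only [Fin.mk.injEq] at hij
    exact Fin.ext (by omega)

theorem mem_ker_projLast (h : d ≤ n) {x : Fin n → ℝ} :
    x ∈ LinearMap.ker (projLast h) ↔ ∀ i : Fin n, n - d ≤ i → x i = 0 := by
  rw [LinearMap.mem_ker]
  constructor
  · intro hx i hi
    have := congrFun hx ⟨i - (n - d), by omega⟩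
    simp only [projLast, LinearMap.funLeft_apply, Pi.zero_apply] at this
    rw [← this]
    congr 1
    exact Fin.ext (by simp; omega)
  · intro hx
    funext j
    exact hx _ (by simp)

/-- The elements of `S ⊆ range n` as elements of `Fin n`. -/
def finSubtypeEquiv (hS : S ⊆ range n) : {i : Fin n // (i : ℕ) ∈ S} ≃ S where
  toFun i := ⟨i.1, i.2⟩
  invFun k := ⟨⟨k.1, mem_range.1 (hS k.2)⟩, k.2⟩

theorem card_finSubtype (hS : S ⊆ range n) : Fintype.card {i : Fin n // (i : ℕ) ∈ S} = #S := by
  rw [Fintype.card_congr (finSubtypeEquiv hS), Fintype.card_coe]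

theorem sum_finSubtype (hS : S ⊆ range n) (g : ℕ → ℝ) :
    ∑ i : {i : Fin n // (i : ℕ) ∈ S}, g i.1 = ∑ k ∈ S, g k := by
  rw [← sum_coe_sort S g, ← (finSubtypeEquiv hS).sum_comp]
  rfl

/-- The coefficients of a functional on `ℝ^S`, extended by zero. -/
noncomputable def coeffVector (φ : Module.Dual ℝ ({i : Fin n // (i : ℕ) ∈ S} → ℝ)) (k : ℕ) : ℝ :=
  by classical exact if h : ∃ _ : k < n, k ∈ S then φ (Pi.single ⟨⟨k, h.1⟩, h.2⟩ 1) else 0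

theorem coeffVector_apply (φ : Module.Dual ℝ ({i : Fin n // (i : ℕ) ∈ S} → ℝ))
    (i : {i : Fin n // (i : ℕ) ∈ S}) [DecidableEq {i : Fin n // (i : ℕ) ∈ S}] :
    coeffVector φ i.1 = φ (Pi.single i 1) := by
  unfold coeffVector
  rw [dif_pos ⟨i.1.2, i.2⟩]
  congr!

theorem dual_eq_sum_coeffVector (φ : Module.Dual ℝ ({i : Fin n // (i : ℕ) ∈ S} → ℝ))
    (w : {i : Fin n // (i : ℕ) ∈ S} → ℝ) : φ w = ∑ i, w i * coeffVector φ i.1 := by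
  classical
  rw [LinearMap.pi_apply_eq_sum_univ φ w]
  refine sum_congr rfl fun i _ => ?_
  rw [coeffVector_apply, smul_eq_mul]
  congr 2
  ext j
  simp [Pi.single_apply, eq_comm]

/-- Testing the annihilator on the unit vectors killed by the projection gives the equations of a
dependency. -/
theorem isDependency_coeffVector (h : d ≤ n) (hS : S ⊆ range n)
    {φ : Module.Dual ℝ ({i : Fin n // (i : ℕ) ∈ S} → ℝ)}
    (hφ : φ ∈ (Submodule.map (faceMap n ε s S) (LinearMap.ker (projLast h))).dualAnnihilator) :
    IsDependency ε (n - d) S (fun i => (s i : ℝ)) (coeffVector φ) := by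
  classical
  have hoff : ∀ k ∉ S, coeffVector φ k = 0 := fun k hk => by
    unfold coeffVector
    rw [dif_neg fun h => hk h.2]
  refine ⟨hoff, fun q hq => ?_⟩
  have hx : Pi.single (⟨q, by omega⟩ : Fin n) (1 : ℝ) ∈ LinearMap.ker (projLast h) := by
    rw [mem_ker_projLast]
    intro i hi
    rw [Pi.single_eq_of_ne]
    intro e
    rw [e] at hi
    simp only at hi
    omega
  have h1 := (Submodule.mem_dualAnnihilator φ).1 hφ _ (Submodule.mem_map_of_mem hx)
  rw [dual_eq_sum_coeffVector] at h1
  have h2 : ∀ i : {i : Fin n // (i : ℕ) ∈ S},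
      faceMap n ε s S (Pi.single (⟨q, by omega⟩ : Fin n) (1 : ℝ)) i * coeffVector φ i.1 =
      (fun k : ℕ => coeffVector φ k * lowerCoeff k q +
        if k = q then ε * ((s k : ℝ) * coeffVector φ k) else 0) i.1 := by
    intro i
    rw [faceMap_apply, lowerPart_eq, lowerPartₗ_eq_sum]
    simp only [Pi.single_apply, Fin.ext_iff]
    rw [sum_eq_single_of_mem (⟨q, by omega⟩ : Fin n) (mem_univ _)
      (fun j _ hj => by rw [if_neg (fun e => hj (Fin.ext e)), mul_zero])]
    simp only [if_true]
    split_ifs <;> ring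
  rw [sum_congr rfl fun i _ => h2 i, sum_finSubtype hS (fun k : ℕ =>
    coeffVector φ k * lowerCoeff k q + if k = q then ε * ((s k : ℝ) * coeffVector φ k) else 0),
    sum_add_distrib, sum_ite_eq'] at h1
  rw [← h1, add_comm]
  congr 1
  split_ifs with hqS
  · rfl
  · rw [hoff q hqS]; simp

theorem eq_zero_of_coeffVector {φ : Module.Dual ℝ ({i : Fin n // (i : ℕ) ∈ S} → ℝ)}
    (h : coeffVector φ = 0) : φ = 0 := by
  refine LinearMap.ext fun w => ?_
  rw [dual_eq_sum_coeffVector, h]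
  simp

theorem coeffVector_sub_smul (φ ψ : Module.Dual ℝ ({i : Fin n // (i : ℕ) ∈ S} → ℝ)) (c : ℝ) (k : ℕ) :
    coeffVector (ψ - c • φ) k = coeffVector ψ k - c * coeffVector φ k := by
  unfold coeffVector
  split_ifs <;> simp

theorem exists_firstMissing (S : Finset ℕ) : ∃ p, range p ⊆ S ∧ p ∉ S := by
  classical
  have hex : ∃ p, p ∉ S := Infinite.exists_notMem_finset S
  refine ⟨Nat.find hex, fun q hq => ?_, Nat.find_spec hex⟩
  by_contra hcon
  exact Nat.find_min hex (mem_range.1 hq) hcon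

/-- All dependencies of `m + 1` rows have the signs that are expected for small `ε`. -/
def HasExpectedSigns (n m : ℕ) (ε : ℝ) : Prop :=
  ∀ S ⊆ range n, #S = m + 1 → ∀ p, range p ⊆ S → p ∉ S →
    ∀ σ v : ℕ → ℝ, (∀ i, |σ i| = 1) → IsDependency ε m S σ v → v ≠ 0 → SignPattern S p σ v

theorem HasExpectedSigns.ne_zero {m : ℕ} (H : HasExpectedSigns n m ε) (hS : S ⊆ range n)
    (hc : #S = m + 1) {σ v : ℕ → ℝ} (hσ : ∀ i, |σ i| = 1) (hv : IsDependency ε m S σ v)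
    (h0 : v ≠ 0) : ∀ i ∈ S, v i ≠ 0 := by
  obtain ⟨p, hp, hpS⟩ := exists_firstMissing S
  exact (H S hS hc p hp hpS σ v hσ hv h0).ne_zero

/-- A dependency of fewer rows, padded to `m + 1` rows, would have a zero entry. -/
theorem HasExpectedSigns.lt_card {m : ℕ} (H : HasExpectedSigns n m ε) (hm : m < n)
    (hS : S ⊆ range n) {σ v : ℕ → ℝ} (hσ : ∀ i, |σ i| = 1) (hv : IsDependency ε m S σ v)
    (h0 : v ≠ 0) : m + 1 ≤ #S := by
  by_contra hcon
  obtain ⟨T, hST, hT, hc⟩ := exists_subsuperset_card_eq (n := m + 1) hS (by omega)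
    (by rw [card_range]; omega)
  have hvT : IsDependency ε m T σ v := by
    refine ⟨fun i hi => hv.1 i fun h => hi (hST h), fun q hq => ?_⟩
    rw [← sum_subset hST fun i _ hi => by rw [hv.1 i hi, zero_mul]]
    exact hv.2 q hq
  have h1 : T ⊆ S := fun i hi => by
    by_contra hiS
    exact H.ne_zero hT hc hσ hvT h0 i hi (hv.1 i hiS)
  have := card_le_card h1
  omega

/-- Of two dependencies of `n - d + 1` rows, a multiple of one can be subtracted from the other to
cancel an entry; full support then makes the difference zero. -/
theorem HasExpectedSigns.finrank_dualAnnihilator_eq_one_iff (h : d ≤ n) (hd : 1 ≤ d)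
    (H : HasExpectedSigns n (n - d) ε) (hs : ∀ i, s i = 1 ∨ s i = -1) (hS : S ⊆ range n) :
    Module.finrank ℝ
      (Submodule.map (faceMap n ε s S) (LinearMap.ker (projLast h))).dualAnnihilator = 1 ↔
      #S = n - d + 1 := by
  set N := Submodule.map (faceMap n ε s S) (LinearMap.ker (projLast h)) with hN
  have h1 := Subspace.finrank_add_finrank_dualAnnihilator_eq N
  rw [Module.finrank_fintype_fun_eq_card, card_finSubtype hS] at h1
  have h2 : Module.finrank ℝ N ≤ n - d := by
    have h3 := LinearMap.finrank_range_add_finrank_ker (projLast h)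
    rw [LinearMap.range_eq_top.2 (projLast_surjective h), finrank_top,
      Module.finrank_fintype_fun_eq_card, Module.finrank_fintype_fun_eq_card, Fintype.card_fin,
      Fintype.card_fin] at h3
    have h4 := Submodule.finrank_map_le (faceMap n ε s S) (LinearMap.ker (projLast h))
    rw [← hN] at h4
    omega
  have hσ := abs_sign hs
  constructor
  · intro h3
    have : 0 < Module.finrank ℝ N.dualAnnihilator := by omega
    obtain ⟨φ, hφN, hφ⟩ := exists_mem_ne_zero_of_finrank_pos this
    have := H.lt_card (by omega) hS hσ (isDependency_coeffVector h hS hφN)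
      fun e => hφ (eq_zero_of_coeffVector e)
    omega
  · intro hc
    have hpos : 0 < Module.finrank ℝ N.dualAnnihilator := by omega
    obtain ⟨φ, hφN, hφ⟩ := exists_mem_ne_zero_of_finrank_pos hpos
    have hne := H.ne_zero hS hc hσ (isDependency_coeffVector h hS hφN)
      fun e => hφ (eq_zero_of_coeffVector e)
    obtain ⟨i, hi⟩ : S.Nonempty := card_pos.1 (by omega)
    refine le_antisymm (finrank_le_one (⟨φ, hφN⟩ : N.dualAnnihilator) fun ψ => ?_) hpos
    refine ⟨coeffVector ψ.1 i / coeffVector φ i, ?_⟩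
    set c := coeffVector ψ.1 i / coeffVector φ i with hc'
    have hmem : ψ.1 - c • φ ∈ N.dualAnnihilator :=
      Submodule.sub_mem _ ψ.2 (Submodule.smul_mem _ _ hφN)
    have h0 : coeffVector (ψ.1 - c • φ) = 0 := by
      by_contra hcon
      refine H.ne_zero hS hc hσ (isDependency_coeffVector h hS hmem) hcon i hi ?_
      rw [coeffVector_sub_smul, hc', div_mul_cancel₀ _ (hne i hi), sub_self]
    exact Subtype.ext (sub_eq_zero.1 (eq_zero_of_coeffVector h0)).symm

theorem exists_dependency (h : d ≤ n) (hS : S ⊆ range n) (hc : #S = n - d + 1) :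
    ∃ v : ℕ → ℝ, v ≠ 0 ∧ IsDependency ε (n - d) S (fun i => (s i : ℝ)) v := by
  have h1 := Subspace.finrank_add_finrank_dualAnnihilator_eq
    (Submodule.map (faceMap n ε s S) (LinearMap.ker (projLast h)))
  rw [Module.finrank_fintype_fun_eq_card, card_finSubtype hS] at h1
  have h3 := LinearMap.finrank_range_add_finrank_ker (projLast h)
  rw [LinearMap.range_eq_top.2 (projLast_surjective h), finrank_top,
    Module.finrank_fintype_fun_eq_card, Module.finrank_fintype_fun_eq_card, Fintype.card_fin,
    Fintype.card_fin] at h3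
  have h4 := Submodule.finrank_map_le (faceMap n ε s S) (LinearMap.ker (projLast h))
  have hpos : 0 < Module.finrank ℝ
    (Submodule.map (faceMap n ε s S) (LinearMap.ker (projLast h))).dualAnnihilator := by omega
  obtain ⟨φ, hφN, hφ⟩ := exists_mem_ne_zero_of_finrank_pos hpos
  exact ⟨coeffVector φ, fun e => hφ (eq_zero_of_coeffVector e),
    isDependency_coeffVector h hS hφN⟩

theorem finrank_vectorSpan_image_cubeFace (h : d ≤ n) (hε : 0 < ε) (hε1 : ε ≤ 1)
    (hs : ∀ i, s i = 1 ∨ s i = -1) :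
    Module.finrank ℝ (vectorSpan ℝ (projLast h '' cubeFace n ε (signedImage s S))) +
      Module.finrank ℝ
        (Submodule.map (faceMap n ε s S) (LinearMap.ker (projLast h))).dualAnnihilator = d := by
  have h1 := AffineMap.map_vectorSpan (projLast h).toAffineMap
    (s := cubeFace n ε (signedImage s S))
  rw [vectorSpan_cubeFace hε hε1 hs] at h1
  have h2 := finrank_map_ker_add_finrank_dualAnnihilator (projLast h) (faceMap n ε s S)
    (projLast_surjective h) (faceMap_surjective hε hs)
  rw [Module.finrank_fintype_fun_eq_card, Fintype.card_fin] at h2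
  conv_rhs => rw [← h2]
  rw [add_left_inj]
  exact congrArg (fun M : Submodule ℝ (Fin d → ℝ) => Module.finrank ℝ M) h1.symm

theorem finrank_vectorSpan_cubicalPolytope (h : d ≤ n) (hε : 0 < ε) (hε1 : ε ≤ 1) :
    Module.finrank ℝ (vectorSpan ℝ (cubicalPolytope h ε)) = d := by
  have h1 := finrank_vectorSpan_image_cubeFace (S := ∅) (s := fun _ => 1) h hε hε1
    fun _ => Or.inl rfl
  have h2 : cubeFace n ε (signedImage (fun _ => 1) ∅) = deformedCube n ε := by
    ext x
    simp [mem_cubeFace_signedImage]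
  rw [h2] at h1
  have h3 := Subspace.finrank_add_finrank_dualAnnihilator_eq
    (Submodule.map (faceMap n ε (fun _ => 1) ∅) (LinearMap.ker (projLast h)))
  rw [Module.finrank_fintype_fun_eq_card, card_finSubtype (empty_subset _), card_empty] at h3
  rw [cubicalPolytope]
  omega

end

/-! ### Supporting functionals and facets -/

variable {n d : ℕ} {ε : ℝ} {s : ℕ → ℤ} {S : Finset ℕ} {v : ℕ → ℝ}

/-- The combination of the left-hand sides of the inequalities of the deformed cube with signs `s`
and weights `v`. -/
noncomputable def combination (n : ℕ) (ε : ℝ) (s : ℕ → ℤ) (v : ℕ → ℝ) : (Fin n → ℝ) →ₗ[ℝ] ℝ :=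
  ∑ i : Fin n, v i • (lowerPartₗ i + ((s i : ℝ) * ε) • LinearMap.proj i)

theorem combination_apply (x : Fin n → ℝ) :
    combination n ε s v x = ∑ i : Fin n, v i * (lowerPart x i + (s i : ℝ) * ε * x i) := by
  simp [combination, lowerPart_eq, mul_add]

theorem combination_eq_sum_coeff (x : Fin n → ℝ) :
    combination n ε s v x =
      ∑ q : Fin n, (ε * ((s q : ℝ) * v q) + ∑ i ∈ range n, v i * lowerCoeff i q) * x q := by
  simp only [combination_apply, lowerPart_eq, lowerPartₗ_eq_sum, mul_add, add_mul, sum_add_distrib,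
    mul_sum, sum_mul]
  rw [add_comm]
  congr 1
  · exact sum_congr rfl fun i _ => by ring
  · rw [sum_comm]
    refine sum_congr rfl fun q _ => ?_
    rw [← Fin.sum_univ_eq_sum_range (fun i => v i * lowerCoeff i q * x q)]
    exact sum_congr rfl fun i _ => by ring

theorem combination_le_and_eq_iff (hs : ∀ i, s i = 1 ∨ s i = -1) (hpos : ∀ i ∈ S, 0 < v i)
    (hzero : ∀ i ∉ S, v i = 0) {x : Fin n → ℝ} (hx : x ∈ deformedCube n ε) (hε : 0 < ε) :
    combination n ε s v x ≤ ∑ i : Fin n, v i * bound ε i ∧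
      (combination n ε s v x = ∑ i : Fin n, v i * bound ε i ↔
        x ∈ cubeFace n ε (signedImage s S)) := by
  have hrow : ∀ i : Fin n, lowerPart x i + (s i : ℝ) * ε * x i ≤ bound ε i := fun i => by
    have h1 := hx i
    have h2 : (s i : ℝ) * x i ≤ |x i| := by
      refine (le_abs_self _).trans_eq ?_
      rw [abs_mul, abs_sign hs, one_mul]
    nlinarith
  have hterm : ∀ i ∈ (univ : Finset (Fin n)),
      v i * (lowerPart x i + (s i : ℝ) * ε * x i) ≤ v i * bound ε i := fun i _ => by
    refine mul_le_mul_of_nonneg_left (hrow i) ?_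
    by_cases hi : (i : ℕ) ∈ S
    · exact (hpos i hi).le
    · exact (hzero i hi).ge
  rw [combination_apply]
  refine ⟨sum_le_sum hterm, ?_⟩
  rw [sum_eq_sum_iff_of_le hterm, mem_cubeFace_signedImage hs]
  constructor
  · exact fun h => ⟨hx, fun i hi => mul_left_cancel₀ (hpos i hi).ne' (h i (mem_univ i))⟩
  · intro h i _
    by_cases hi : (i : ℕ) ∈ S
    · rw [h.2 i hi]
    · rw [hzero i hi, zero_mul, zero_mul]

/-- Every functional is a combination of the left-hand sides with nonnegative weights. -/
theorem exists_eq_combination (hε : 0 < ε) (c : (Fin n → ℝ) →ₗ[ℝ] ℝ) :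
    ∃ (s : ℕ → ℤ) (v : ℕ → ℝ), (∀ i, s i = 1 ∨ s i = -1) ∧ (∀ i, 0 ≤ v i) ∧ (∀ i, n ≤ i → v i = 0) ∧
      c = combination n ε s v := by
  classical
  set c' : ℕ → ℝ := fun q => if h : q < n then c (Pi.single ⟨q, h⟩ 1) else 0 with hc'
  -- Back substitution over the last `k` coordinates: coefficient `q` depends on `s q * v q` and on
  -- later weights only. The required number `r` is split into a sign and an absolute value.
  have key : ∀ k ≤ n, ∃ (s : ℕ → ℤ) (v : ℕ → ℝ), (∀ i, s i = 1 ∨ s i = -1) ∧ (∀ i, 0 ≤ v i) ∧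
      (∀ i, n ≤ i → v i = 0) ∧ ∀ q, n - k ≤ q → q < n →
        ε * ((s q : ℝ) * v q) + ∑ i ∈ range n, v i * lowerCoeff i q = c' q := by
    intro k
    induction k with
    | zero => exact fun _ => ⟨fun _ => 1, fun _ => 0, fun _ => Or.inl rfl, fun _ => le_rfl,
        fun _ _ => rfl, fun q h1 h2 => by omega⟩
    | succ k ih =>
      intro hk
      obtain ⟨s, v, hs, hv, hvn, h⟩ := ih (by omega)
      set q₀ := n - (k + 1) with hq₀
      set r := (c' q₀ - ∑ i ∈ range n, v i * lowerCoeff i q₀) / ε with hr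
      have hsum : ∀ q, q₀ ≤ q → ∑ i ∈ range n, Function.update v q₀ |r| i * lowerCoeff i q =
          ∑ i ∈ range n, v i * lowerCoeff i q := fun q hq => by
        refine sum_congr rfl fun i _ => ?_
        rcases eq_or_ne i q₀ with rfl | hi
        · simp [lowerCoeff, not_lt.2 hq]
        · rw [Function.update_of_ne hi]
      refine ⟨Function.update s q₀ (if 0 ≤ r then 1 else -1), Function.update v q₀ |r|, fun i => ?_,
        fun i => ?_, fun i hi => ?_, fun q h1 h2 => ?_⟩
      · rcases eq_or_ne i q₀ with rfl | hi
        · rw [Function.update_self]; split_ifs <;> simp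
        · rw [Function.update_of_ne hi]; exact hs i
      · rcases eq_or_ne i q₀ with rfl | hi
        · rw [Function.update_self]; exact abs_nonneg r
        · rw [Function.update_of_ne hi]; exact hv i
      · rw [Function.update_of_ne (by omega)]; exact hvn i hi
      · rw [hsum q h1]
        rcases eq_or_ne q q₀ with rfl | hq
        · rw [Function.update_self, Function.update_self]
          have e : (((if 0 ≤ r then 1 else -1 : ℤ)) : ℝ) * |r| = r := by
            split_ifs with h0
            · rw [abs_of_nonneg h0]; simp
            · rw [abs_of_neg (not_le.1 h0)]; simp
          rw [e, hr]
          field_simp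
          ring
        · rw [Function.update_of_ne hq, Function.update_of_ne hq]
          exact h q (by omega) h2
  obtain ⟨s, v, hs, hv, hvn, h⟩ := key n le_rfl
  refine ⟨s, v, hs, hv, hvn, LinearMap.ext fun x => ?_⟩
  rw [LinearMap.pi_apply_eq_sum_univ c x, combination_eq_sum_coeff]
  refine sum_congr rfl fun q _ => ?_
  rw [h q (by omega) q.2, hc', smul_eq_mul, mul_comm]
  simp only [q.2, dif_pos]
  congr 2
  ext j
  simp [Pi.single_apply, eq_comm]

theorem isDependency_iff_ker_le (h : d ≤ n) (hS : S ⊆ range n) (hzero : ∀ i ∉ S, v i = 0) :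
    IsDependency ε (n - d) S (fun i => (s i : ℝ)) v ↔
      LinearMap.ker (projLast h) ≤ LinearMap.ker (combination n ε s v) := by
  classical
  have hsum : ∀ q, ∑ i ∈ S, v i * lowerCoeff i q = ∑ i ∈ range n, v i * lowerCoeff i q :=
    fun q => sum_subset hS fun i _ hi => by rw [hzero i hi, zero_mul]
  constructor
  · intro hv x hx
    rw [LinearMap.mem_ker, combination_eq_sum_coeff]
    refine sum_eq_zero fun q _ => ?_
    by_cases hq : (q : ℕ) < n - d
    · rw [← hsum, hv.2 q hq, zero_mul]
    · rw [(mem_ker_projLast h).1 hx q (by omega), mul_zero]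
  · refine fun hle => ⟨hzero, fun q hq => ?_⟩
    have hx : Pi.single (⟨q, by omega⟩ : Fin n) (1 : ℝ) ∈ LinearMap.ker (projLast h) := by
      rw [mem_ker_projLast]
      intro i hi
      rw [Pi.single_eq_of_ne]
      intro e
      rw [e] at hi
      simp only at hi
      omega
    have h1 := LinearMap.mem_ker.1 (hle hx)
    rw [combination_eq_sum_coeff, sum_eq_single_of_mem (⟨q, by omega⟩ : Fin n) (mem_univ _)
      (fun j _ hj => by rw [Pi.single_eq_of_ne hj, mul_zero]), Pi.single_eq_same, mul_one] at h1
    rw [hsum]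
    exact h1

/-- The faces of the projection on which the maximum of a functional is attained. -/
theorem exposed_eq_image_cubeFace (h : d ≤ n) (hε : 0 < ε) (hε1 : ε ≤ 1)
    (hs : ∀ i, s i = 1 ∨ s i = -1) (hpos : ∀ i ∈ S, 0 < v i) (hzero : ∀ i ∉ S, v i = 0)
    {l : (Fin d → ℝ) →ₗ[ℝ] ℝ} (hl : l ∘ₗ projLast h = combination n ε s v) :
    {p ∈ cubicalPolytope h ε | ∀ p' ∈ cubicalPolytope h ε, l p' ≤ l p} =
        projLast h '' cubeFace n ε (signedImage s S) ∧
      ∀ x ∈ deformedCube n ε, projLast h x ∈ projLast h '' cubeFace n ε (signedImage s S) →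
        x ∈ cubeFace n ε (signedImage s S) := by
  have hl' : ∀ x, l (projLast h x) = combination n ε s v x := fun x => by rw [← hl]; rfl
  have hM := fun (x : Fin n → ℝ) (hx : x ∈ deformedCube n ε) =>
    combination_le_and_eq_iff hs hpos hzero hx hε
  obtain ⟨x₀, hx₀, -⟩ := exists_face_center (n := n) hε hε1 hs S
  have hx₀M := (hM x₀ hx₀.1).2.2 hx₀
  constructor
  · ext p
    constructor
    · rintro ⟨⟨x, hx, rfl⟩, hmax⟩
      refine ⟨x, (hM x hx).2.1 (le_antisymm (hM x hx).1 ?_), rfl⟩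
      have := hmax _ ⟨x₀, hx₀.1, rfl⟩
      rwa [hl', hl', hx₀M] at this
    · rintro ⟨x, hx, rfl⟩
      refine ⟨⟨x, hx.1, rfl⟩, ?_⟩
      rintro _ ⟨y, hy, rfl⟩
      rw [hl', hl', (hM x hx.1).2.2 hx]
      exact (hM y hy).1
  -- The functional on the projection sees only the image, so a cube point over the face also
  -- attains the maximum.
  · rintro x hx ⟨y, hy, hyx⟩
    refine (hM x hx).2.1 ?_
    rw [← hl', ← hyx, hl']
    exact (hM y hy.1).2.2 hy

/-- The rows of `S` with signs `s` have a dependency with positive coefficients. -/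
def HasPositiveDependency (n d : ℕ) (ε : ℝ) (s : ℕ → ℤ) (S : Finset ℕ) : Prop :=
  ∃ v : ℕ → ℝ, (∀ i ∈ S, 0 < v i) ∧ IsDependency ε (n - d) S (fun i => (s i : ℝ)) v

/-- A functional that vanishes on the kernel of the projection factors through it. -/
theorem HasPositiveDependency.exists_functional (h : d ≤ n) (hS : S ⊆ range n)
    (hp : HasPositiveDependency n d ε s S) :
    ∃ v : ℕ → ℝ, (∀ i ∈ S, 0 < v i) ∧ (∀ i ∉ S, v i = 0) ∧
      ∃ l : (Fin d → ℝ) →ₗ[ℝ] ℝ, l ∘ₗ projLast h = combination n ε s v := by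
  obtain ⟨v, hpos, hv⟩ := hp
  refine ⟨v, hpos, hv.1, ?_⟩
  have h1 := (isDependency_iff_ker_le h hS hv.1).1 hv
  have h2 : combination n ε s v ∈ LinearMap.range (projLast h).dualMap := by
    rw [LinearMap.range_dualMap_eq_dualAnnihilator_ker, Submodule.mem_dualAnnihilator]
    exact fun x hx => LinearMap.mem_ker.1 (h1 hx)
  obtain ⟨l, hl⟩ := h2
  exact ⟨l, hl⟩

theorem HasExpectedSigns.isFacet_iff (h : d ≤ n) (hd : 1 ≤ d) (hε : 0 < ε) (hε1 : ε ≤ 1)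
    (H : HasExpectedSigns n (n - d) ε) (F : Set (Fin d → ℝ)) :
    IsFacet (cubicalPolytope h ε) F ↔
      ∃ (s : ℕ → ℤ) (S : Finset ℕ), (∀ i, s i = 1 ∨ s i = -1) ∧ S ⊆ range n ∧ #S = n - d + 1 ∧
        HasPositiveDependency n d ε s S ∧ F = projLast h '' cubeFace n ε (signedImage s S) := by
  have hP := finrank_vectorSpan_cubicalPolytope h hε hε1
  constructor
  · rintro ⟨hne, hexp, hdim⟩
    obtain ⟨l, hl⟩ := hexp hne
    obtain ⟨s, v, hs, hv0, hvn, hv⟩ :=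
      exists_eq_combination hε ((l : (Fin d → ℝ) →ₗ[ℝ] ℝ) ∘ₗ projLast h)
    set S : Finset ℕ := {i ∈ range n | v i ≠ 0} with hS
    have hSn : S ⊆ range n := filter_subset _ _
    have hpos : ∀ i ∈ S, 0 < v i := fun i hi => (hv0 i).lt_of_ne' (mem_filter.1 hi).2
    have hzero : ∀ i ∉ S, v i = 0 := fun i hi => by
      by_contra hcon
      by_cases hin : i < n
      · exact hi (mem_filter.2 ⟨mem_range.2 hin, hcon⟩)
      · exact hcon (hvn i (not_lt.1 hin))
    have hF : F = projLast h '' cubeFace n ε (signedImage s S) := by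
      rw [← (exposed_eq_image_cubeFace h hε hε1 hs hpos hzero hv).1, hl]
      rfl
    have hdep : IsDependency ε (n - d) S (fun i => (s i : ℝ)) v := by
      rw [isDependency_iff_ker_le h hSn hzero, ← hv]
      exact LinearMap.ker_le_ker_comp _ _
    refine ⟨s, S, hs, hSn, ?_, ⟨v, hpos, hdep⟩, hF⟩
    rw [← H.finrank_dualAnnihilator_eq_one_iff h hd hs hSn]
    have := finrank_vectorSpan_image_cubeFace (S := S) h hε hε1 hs
    rw [hP, hF] at hdim
    omega
  · rintro ⟨s, S, hs, hSn, hc, hp, rfl⟩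
    obtain ⟨v, hpos, hzero, l, hl⟩ := hp.exists_functional h hSn
    obtain ⟨x, hx, -⟩ := exists_face_center (n := n) hε hε1 hs S
    refine ⟨⟨_, x, hx, rfl⟩, fun _ => ⟨LinearMap.toContinuousLinearMap l, ?_⟩, ?_⟩
    · exact (exposed_eq_image_cubeFace h hε hε1 hs hpos hzero hl).1.symm
    · have h1 := finrank_vectorSpan_image_cubeFace (S := S) h hε hε1 hs
      have h2 := (H.finrank_dualAnnihilator_eq_one_iff h hd hs hSn).2 hc
      rw [hP]
      omega

/-- The part of the cube over `π(F_α')` is `F_α'` itself, so `F_α ⊆ F_α'` and `α' ⊆ α`; equal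
cardinalities finish. A positive dependency is needed for `α'` only. -/
theorem signedImage_eq_of_image_eq (h : d ≤ n) (hε : 0 < ε) (hε1 : ε ≤ 1)
    (hs : ∀ i, s i = 1 ∨ s i = -1) (hc : #S = n - d + 1)
    {s' : ℕ → ℤ} {S' : Finset ℕ} (hs' : ∀ i, s' i = 1 ∨ s' i = -1) (hS' : S' ⊆ range n)
    (hc' : #S' = n - d + 1) (hp : HasPositiveDependency n d ε s' S')
    (he : projLast h '' cubeFace n ε (signedImage s S) =
      projLast h '' cubeFace n ε (signedImage s' S')) :
    signedImage s S = signedImage s' S' := by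
  obtain ⟨v, hpos, hzero, l, hl⟩ := hp.exists_functional h hS'
  have h1 := (exposed_eq_image_cubeFace h hε hε1 hs' hpos hzero hl).2
  refine (eq_of_subset_of_card_le (signedImage_subset_of_cubeFace_subset (n := n) hε hε1 hs hs' hS'
    fun x hx => h1 x hx.1 (he ▸ ⟨x, hx, rfl⟩)) ?_).symm
  rw [card_signedImage hs, card_signedImage hs', hc, hc']

theorem HasExpectedSigns.cubicalGaleEven_iff (h : d ≤ n)
    (H : HasExpectedSigns n (n - d) ε) (hs : ∀ i, s i = 1 ∨ s i = -1) (hS : S ⊆ range n)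
    (hc : #S = n - d + 1) :
    CubicalGaleEven n d (signedImage s S) ↔ HasPositiveDependency n d ε s S := by
  obtain ⟨p, hr, hp⟩ := exists_firstMissing S
  have hne : S.Nonempty := card_pos.1 (by omega)
  have hσ := abs_sign hs
  rw [cubicalGaleEven_iff_signCondition hs hc hr hp]
  constructor
  · intro hcond
    obtain ⟨v, hv0, hv⟩ := exists_dependency (ε := ε) (s := s) h hS hc
    obtain ⟨e, -, hpos⟩ := (H S hS hc p hr hp _ v hσ hv hv0).exists_forall_mul_pos hne hr hp hcond
    -- Scaling by one entry makes the common sign positive.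
    refine ⟨fun i => v i * v e, hpos, fun i hi => mul_eq_zero_of_left (hv.1 i hi) _, fun q hq => ?_⟩
    have h1 := hv.2 q hq
    have h2 : ∑ i ∈ S, v i * v e * lowerCoeff i q = v e * ∑ i ∈ S, v i * lowerCoeff i q := by
      rw [mul_sum]
      exact sum_congr rfl fun i _ => by ring
    rw [h2]
    linear_combination v e * h1
  · rintro ⟨v, hpos, hv⟩
    obtain ⟨i, hi⟩ := hne
    have hv0 : v ≠ 0 := fun h0 => by
      have := hpos i hi
      rw [h0] at this
      exact lt_irrefl _ this
    exact (H S hS hc p hr hp _ v hσ hv hv0).signCondition hs hr hpos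

theorem IsSignedSubset.exists_eq_signedImage {α : Finset ℤ} (h : IsSignedSubset n α) :
    ∃ (s : ℕ → ℤ) (S : Finset ℕ), (∀ i, s i = 1 ∨ s i = -1) ∧ S ⊆ range n ∧ α = signedImage s S := by
  classical
  set s : ℕ → ℤ := fun i => if (i : ℤ) + 1 ∈ α then 1 else -1 with hs
  refine ⟨s, {i ∈ range n | s i * ((i : ℤ) + 1) ∈ α}, fun i => ?_, filter_subset _ _, ?_⟩
  · simp only [hs]
    split_ifs <;> simp
  · ext a
    simp only [signedImage, mem_image, mem_filter, mem_range]
    constructor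
    · intro ha
      obtain ⟨h1, h2⟩ := h.1 a ha
      have h3 := Int.natCast_natAbs a
      have hsa : s (a.natAbs - 1) * (((a.natAbs - 1 : ℕ) : ℤ) + 1) = a := by
        have e : ((a.natAbs - 1 : ℕ) : ℤ) + 1 = |a| := by omega
        simp only [hs, e]
        rcases abs_cases a with ⟨e2, _⟩ | ⟨e2, _⟩
        · rw [e2, if_pos ha, one_mul]
        · rw [e2, if_neg (h.2 a ha)]; simp
      exact ⟨a.natAbs - 1, ⟨by omega, hsa.symm ▸ ha⟩, hsa⟩
    · rintro ⟨i, ⟨-, hi⟩, rfl⟩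
      exact hi

theorem isSignedSubset_signedImage (hs : ∀ i, s i = 1 ∨ s i = -1) (hS : S ⊆ range n) :
    IsSignedSubset n (signedImage s S) := by
  constructor
  · intro a ha
    obtain ⟨i, hi, rfl⟩ := mem_image.1 ha
    have := mem_range.1 (hS hi)
    rw [abs_sign_mul_succ hs]
    omega
  · intro a ha hna
    obtain ⟨i, hi, rfl⟩ := mem_image.1 ha
    rw [← neg_mul] at hna
    have h1 : -s i = 1 ∨ -s i = -1 := by rcases hs i with h | h <;> simp [h]
    have := ((mul_succ_mem_signedImage hs h1).1 hna).2
    rcases hs i with h | h <;> omega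

end CubicalGale

open CubicalGale in
theorem mainTheorem2 (n d : ℕ) (hd : 2 ≤ d) (hdn : d ≤ n) :
    ∃ ε₀ : ℝ, 0 < ε₀ ∧ ∀ ε : ℝ, 0 < ε → ε < ε₀ →
      (∀ α : Finset ℤ, CubicalGale.IsSignedSubset n α → α.card = n - d + 1 →
        (CubicalGale.IsFacet (CubicalGale.cubicalPolytope hdn ε)
            (CubicalGale.projLast hdn '' CubicalGale.cubeFace n ε α) ↔
          CubicalGale.CubicalGaleEven n d α)) ∧
      Set.BijOn (fun α : Finset ℤ => CubicalGale.projLast hdn '' CubicalGale.cubeFace n ε α)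
        {α : Finset ℤ | CubicalGale.IsSignedSubset n α ∧ α.card = n - d + 1 ∧
          CubicalGale.CubicalGaleEven n d α}
        {F : Set (Fin d → ℝ) | CubicalGale.IsFacet (CubicalGale.cubicalPolytope hdn ε) F} := by
  obtain ⟨δ, hδ, hsigns⟩ := exists_forall_signPattern n (n - d)
  refine ⟨min δ 1, lt_min hδ one_pos, fun ε hε hε' => ?_⟩
  have H : HasExpectedSigns n (n - d) ε := hsigns ε hε (hε'.trans_le (min_le_left _ _))
  have hε1 : ε ≤ 1 := (hε'.trans_le (min_le_right _ _)).le
  have hfacet := H.isFacet_iff hdn (by omega) hε hε1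
  have hmain : ∀ α : Finset ℤ, IsSignedSubset n α → α.card = n - d + 1 →
      (IsFacet (cubicalPolytope hdn ε) (projLast hdn '' cubeFace n ε α) ↔
        CubicalGaleEven n d α) := by
    intro α hα hc
    obtain ⟨s, S, hs, hS, rfl⟩ := hα.exists_eq_signedImage
    rw [card_signedImage hs] at hc
    rw [hfacet, H.cubicalGaleEven_iff hdn hs hS hc]
    constructor
    -- The facet is known only as the image of some face with a positive dependency; injectivity
    -- identifies that face with the given one.
    · rintro ⟨s', S', hs', hS', hc', hp, he⟩
      have e := signedImage_eq_of_image_eq hdn hε hε1 hs hc hs' hS' hc' hp he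
      rw [← H.cubicalGaleEven_iff hdn hs hS hc, e, H.cubicalGaleEven_iff hdn hs' hS' hc']
      exact hp
    · exact fun hp => ⟨s, S, hs, hS, hc, hp, rfl⟩
  refine ⟨hmain, fun α hα => (hmain α hα.1 hα.2.1).2 hα.2.2, ?_, ?_⟩
  · rintro α ⟨hα, hc, -⟩ α' ⟨hα', hc', hg'⟩ he
    obtain ⟨s, S, hs, hS, rfl⟩ := hα.exists_eq_signedImage
    obtain ⟨s', S', hs', hS', rfl⟩ := hα'.exists_eq_signedImage
    rw [card_signedImage hs] at hc
    rw [card_signedImage hs'] at hc'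
    exact signedImage_eq_of_image_eq hdn hε hε1 hs hc hs' hS' hc'
      ((H.cubicalGaleEven_iff hdn hs' hS' hc').1 hg') he
  · intro F hF
    obtain ⟨s, S, hs, hS, hc, hp, rfl⟩ := (hfacet F).1 hF
    exact ⟨signedImage s S, ⟨isSignedSubset_signedImage hs hS, by rw [card_signedImage hs, hc],
      (H.cubicalGaleEven_iff hdn hs hS hc).2 hp⟩, rfl⟩
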